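/- Let $n\ge 2$ and let $q,t$ be real numbers with $0<q<1$ and $t>0$. Let $A$ be the algebra of real Laurent polynomials in $x_1,\ldots,x_n$; write $x^\mu=x_1^{\mu_1}\cdots x_n^{\mu_n}$ for $\mu\in\mathbb Z^n$, and call $\mu$ dominant if $\mu_1\ge\cdots\ge\mu_n\ge 0$. Let $\varepsilon_1,\ldots,\varepsilon_n$ be the standard basis of $\mathbb Z^n$, and write $\mu<\lambda$ if $\mu\ne\lambda$ and $\lambda-\mu$ is a nonnegative integer combination of the simple roots $\varepsilon_i-\varepsilon_{i+1}$ ($1\le i<n$) and $2\varepsilon_n$ of $C_n$. Let $m_\mu$ be the sum of $x^\nu$ over the orbit of $\mu$ under signed permutations. The Macdonald operator is \[E_\pi f=\sum_{\sigma\in\{-1,1\}^n}\ \prod_{i=1}^n\frac{1-tx_i^{2\sigma_i}}{1-x_i^{2\sigma_i}}\prod_{1\le i<j\le n}\frac{1-tx_i^{\sigma_i}x_j^{\sigma_j}}{1-x_i^{\sigma_i}x_j^{\sigma_j}}\ f(q^{\sigma_1/2}x_1,\ldots,q^{\sigma_n/2}x_n),\] and $e_\mu=\prod_{i=1}^n\bigl(q^{\mu_i/2}t^{n-i+1}+q^{-\mu_i/2}\bigr)$.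 For dominant $\mu$, the Macdonald polynomial $P_\mu$ is the element of $A$ that is $m_\mu$ plus a linear combination of the $m_\nu$ with $\nu$ dominant, $\nu<\mu$, and satisfies $E_\pi P_\mu=e_\mu P_\mu$. Put \[Q_{(r)}=\prod_{j=0}^{r-1}\frac{1-tq^{j}}{1-q^{j+1}}\ P_{r\varepsilon_1}\qquad(r\ge 0).\] Let $\lambda=(\lambda_1,\lambda_2)$ be a partition, identified with $\lambda_1\varepsilon_1+\lambda_2\varepsilon_2$. If $t>1$, assume in addition that $t$ is generic in the sense that $e_\mu\neq e_{r\varepsilon_1}$ for all $0\le r\le\lambda_1+\lambda_2$ and all dominant $\mu<r\varepsilon_1$. Then $P_{r\varepsilon_1}$ exists and is unique for $0\le r\le \lambda_1+\lambda_2$, and \[\begin{aligned}E_\pi\bigl(Q_{(\lambda_1)}Q_{(\lambda_2)}\bigr)={}&e_\lambda\,Q_{(\lambda_1)}Q_{(\lambda_2)}+(1-t)\prod_{i=1}^{n-2}(t^i+1)\\&\times\Bigl(q^{-\frac12(\lambda_1-\lambda_2)}t^{n-1}\sum_{k=1}^{\lambda_2}q^{-k}\bigl(1-q^{2k+\lambda_1-\lambda_2}\bigr)Q_{(\lambda_1+k)}Q_{(\lambda_2-k)}\\&\qquad-q^{-\frac12(\lambda_1+\lambda_2)}\sum_{k=1}^{\lambda_2}t^{k-1}\bigl(1-q^{-2k+\lambda_1+\lambda_2}t^{2n}\bigr)Q_{(\lambda_1-k)}Q_{(\lambda_2-k)}\Bigr).\end{aligned}\]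 -/

import Mathlib

namespace MacdonaldC

/-! The root system `C_n` in `ℝⁿ`, weight lattice `ℤⁿ`, with one real base `q` and one real
parameter `t` for short and long roots. Index `i : Fin n` is zero-based. -/

/-- The weight lattice `P = ℤ ε₁ ⊕ ⋯ ⊕ ℤ εₙ` of `C_n`. -/
abbrev Weight (n : ℕ) : Type := Fin n → ℤ

/-- Dominant weights of `C_n`: integer vectors with `μ₁ ≥ ⋯ ≥ μₙ ≥ 0`. -/
def IsDominant {n : ℕ} (μ : Weight n) : Prop := Antitone μ ∧ ∀ i, 0 ≤ μ i

/-- The simple roots of `C_n`: `εᵢ - εᵢ₊₁` for `i < n`, and `2 εₙ`. -/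
def simpleRoots (n : ℕ) : Set (Weight n) :=
  {α | ∃ i j : Fin n, (i : ℕ) + 1 = (j : ℕ) ∧ α = Pi.single i 1 - Pi.single j 1} ∪
  {α | ∃ i : Fin n, (i : ℕ) + 1 = n ∧ α = Pi.single i 2}

/-- The strict dominance order: `μ < ν` iff `μ ≠ ν` and `ν - μ` is a nonnegative integer
combination of simple roots. -/
def WeightLT {n : ℕ} (μ ν : Weight n) : Prop :=
  ν - μ ∈ AddSubmonoid.closure (simpleRoots n) ∧ μ ≠ ν

/-- The weight `a ε₁ + b ε₂`. -/
def twoRow (n : ℕ) (a b : ℤ) : Weight n := fun i =>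
  if (i : ℕ) = 0 then a else if (i : ℕ) = 1 then b else 0

/-- The weight `r ε₁`. -/
def oneRow (n : ℕ) (r : ℕ) : Weight n := twoRow n r 0

/-- The group algebra of the weight lattice over `ℝ`: Laurent polynomials in `x₁, …, xₙ`. -/
abbrev LaurentAlg (n : ℕ) : Type := AddMonoidAlgebra ℝ (Weight n)

/-- The field of rational functions in `x₁, …, xₙ`. -/
abbrev RatFun (n : ℕ) : Type := FractionRing (LaurentAlg n)

/-- The orbit of a weight under the Weyl group of signed permutations. -/
def weylOrbit {n : ℕ} (μ : Weight n) : Finset (Weight n) :=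
  Finset.univ.image fun w : Equiv.Perm (Fin n) × (Fin n → ℤˣ) =>
    fun i => ((w.2 i : ℤˣ) : ℤ) * μ (w.1 i)

/-- The orbit sum `m_μ`. -/
noncomputable def orbitSum {n : ℕ} (μ : Weight n) : LaurentAlg n :=
  ∑ ν ∈ weylOrbit μ, AddMonoidAlgebra.single ν (1 : ℝ)

/-- The translation `f(x₁, …, xₙ) ↦ f(q^{σ₁/2} x₁, …, q^{σₙ/2} xₙ)`, that is,
`e^μ ↦ q^{⟨σ, μ⟩/2} e^μ`. -/
noncomputable def shift {n : ℕ} (q : ℝ) (σ : Fin n → ℤˣ) (f : LaurentAlg n) : LaurentAlg n :=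
  ∑ μ ∈ f.coeff.support,
    AddMonoidAlgebra.single μ (Real.sqrt q ^ (∑ i, ((σ i : ℤˣ) : ℤ) * μ i) * f.coeff μ)

/-- The exponential `e^μ`, seen as a rational function. -/
noncomputable def expo {n : ℕ} (μ : Weight n) : RatFun n :=
  algebraMap (LaurentAlg n) (RatFun n) (AddMonoidAlgebra.single μ (1 : ℝ))

/-- The Macdonald operator `E_π` of type `C_n` for the minuscule coweight
`π = (ε₁ + ⋯ + εₙ)/2`. -/
noncomputable def macdonaldE {n : ℕ} (q t : ℝ) (f : LaurentAlg n) : RatFun n :=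
  ∑ σ : Fin n → ℤˣ,
    (∏ i, (1 - t • expo (Pi.single i (2 * ((σ i : ℤˣ) : ℤ)))) /
        (1 - expo (Pi.single i (2 * ((σ i : ℤˣ) : ℤ))))) *
    (∏ i, ∏ j ∈ Finset.Ioi i,
        (1 - t • expo (Pi.single i ((σ i : ℤˣ) : ℤ) + Pi.single j ((σ j : ℤˣ) : ℤ))) /
        (1 - expo (Pi.single i ((σ i : ℤˣ) : ℤ) + Pi.single j ((σ j : ℤˣ) : ℤ)))) *
    algebraMap (LaurentAlg n) (RatFun n) (shift q σ f)

/-- The eigenvalue `e_μ = ∏_{i=1}^n (q^{μᵢ/2} t^{n-i+1} + q^{-μᵢ/2})`. -/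
noncomputable def eigen {n : ℕ} (q t : ℝ) (μ : Weight n) : ℝ :=
  ∏ i : Fin n, (Real.sqrt q ^ μ i * t ^ (n - (i : ℕ)) + Real.sqrt q ^ (-μ i))

/-- `P` is a Macdonald polynomial `P_μ`: it equals `m_μ` plus a linear combination of `m_ν` for
dominant `ν < μ`, and it is an eigenvector of `E_π` with eigenvalue `e_μ`. -/
def IsMacdonald {n : ℕ} (q t : ℝ) (μ : Weight n) (P : LaurentAlg n) : Prop :=
  P - orbitSum μ ∈ Submodule.span ℝ
      {m : LaurentAlg n | ∃ ν : Weight n, IsDominant ν ∧ WeightLT ν μ ∧ m = orbitSum ν} ∧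
  macdonaldE q t P = algebraMap (LaurentAlg n) (RatFun n) (eigen q t μ • P)

open Classical in
/-- The Macdonald polynomial `P_μ` (zero where there is none). -/
noncomputable def macdonaldP {n : ℕ} (q t : ℝ) (μ : Weight n) : LaurentAlg n :=
  if h : ∃ P : LaurentAlg n, IsMacdonald q t μ P then h.choose else 0

/-- The finite `q`-shifted factorial `(u; q)_r`. -/
def qPoch (u q : ℝ) (r : ℕ) : ℝ := ∏ j ∈ Finset.range r, (1 - u * q ^ j)

/-- `Q_{(r)} = (t; q)_r / (q; q)_r · P_{r ε₁}`. -/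
noncomputable def macdonaldQ (n : ℕ) (q t : ℝ) (r : ℕ) : LaurentAlg n :=
  (qPoch t q r / qPoch q q r) • macdonaldP q t (oneRow n r)

end MacdonaldC

open MacdonaldC

/-! Put φ(X) = ∑ (t;q)_r/(q;q)_r X^r and G(X) = ∏ φ(x_i X) φ(x_i⁻¹ X) = ∑ g_r X^r; here g_r is
`oneRowPoly`. The proof computes E_π(g_a g_b) from the generating series and then identifies g_r
with Q_(r).

For signs σ write y_i = x_i^{σ_i}. Since (1 - X) φ(X) = (1 - tX) φ(qX), the translation by σ,
followed by X ↦ q^{1/2} X, multiplies G by N_σ(X)/D(X), where N_σ(X) = ∏ (1 - y_i X)(1 - t y_i⁻¹ X),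
and D(X) = ∏ (1 - t x_i X)(1 - t x_i⁻¹ X) does not depend on σ. So everything rests on the sum ∑_σ
W(y) N_σ(v) N_σ(w), where W is the coefficient of the operator. It is evaluated by interpolation in
v (`GenericPoint.sum_rootWeight_mul_linProd_mul_linProd`): after multiplication by (v - w)(1 - tvw)
both sides are polynomials of degree at most 2n + 2 that agree at 2n + 3 points. At v = x_k^{±1}
half of the terms vanish, and the others form a one-variable sum in n - 1 coordinates, itself found
by interpolation.

Dividing by (v - w)(1 - tvw) in the ring of series and reading off v^a w^b gives the formula for g_a
g_b, for every t > 0 (`macdonaldE_oneRowPoly_mul`). The divisor v - w produces the sum over g_{a+k}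
g_{b-k}, the divisor 1 - tvw the sum over g_{a-k} g_{b-k}.

The case b = 0 says that g_r is an eigenvector for e_{rε₁}. It is invariant, involves only weights
of degree at most r, and has coefficient (t;q)_r/(q;q)_r at rε₁. The lexicographically leading
weight of an eigenvector determines its eigenvalue (`eq_eigen_of_leading`), so P_{rε₁} is unique as
soon as e_{rε₁} differs from e_ν for all dominant ν < rε₁. This is the assumption for t > 1 and an
inequality for t ≤ 1 (`eigen_lt_eigen_oneRow`). If (t;q)_r ≠ 0, then P_{rε₁} is g_r normalized. If
(t;q)_r = 0 with t ≠ 1, then t q^j = 1 for some 0 < j < r; g_{j+1} is nonzero but lacks its top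
term, and its leading weight contradicts genericity. For t = 1 the polynomial P_{rε₁} is an orbit
sum, and both Q_(r) and g_r vanish for r > 0. -/

namespace MacdonaldC

/-! ### Sums over signs of the coefficients of the operator, by interpolation -/

section RationalIdentities

open Polynomial

/-- Symmetry of `F` makes the position of `k` among the indices irrelevant. This isolates the
factors of the weight that involve one coordinate, for recursion on the number of variables. -/
lemma prod_pairs_succAbove {M : Type*} [CommMonoid M] {n : ℕ} (F : Fin (n + 1) → Fin (n + 1) → M)
    (hF : ∀ i j, F i j = F j i) (k : Fin (n + 1)) :
    ∏ i, ∏ j ∈ Finset.Ioi i, F i j =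
      (∏ j, F k (k.succAbove j)) *
        ∏ i, ∏ j ∈ Finset.Ioi i, F (k.succAbove i) (k.succAbove j) := by
  have key : ∀ (m : ℕ) (H : Fin m → Fin m → M),
      ∏ i, ∏ j ∈ Finset.Ioi i, H i j = ∏ i, ∏ j, if i < j then H i j else 1 := by
    intro m H
    refine Finset.prod_congr rfl fun i _ => ?_
    rw [← Finset.prod_filter]
    refine Finset.prod_congr ?_ fun _ _ => rfl
    ext; simp
  rw [key, key, Fin.prod_univ_succAbove _ k, Fin.prod_univ_succAbove _ k]
  simp only [lt_irrefl, if_false, one_mul, Fin.prod_univ_succAbove _ k,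
    Fin.succAbove_lt_succAbove_iff]
  rw [Finset.prod_mul_distrib, ← mul_assoc, ← Finset.prod_mul_distrib]
  congr 1
  refine Finset.prod_congr rfl fun j _ => ?_
  rcases lt_or_gt_of_ne (Fin.succAbove_ne k j) with h | h
  · rw [if_neg (not_lt.mpr h.le), if_pos h, one_mul, hF]
  · rw [if_pos h, if_neg (not_lt.mpr h.le), mul_one]

/-- Pairs the sign vectors that differ only at `k`. In both applications the term with sign `-τ`
vanishes. -/
lemma sum_signs_insertNth {M : Type*} [AddCommMonoid M] {n : ℕ} (k : Fin (n + 1)) (τ : ℤˣ)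
    (f : (Fin (n + 1) → ℤˣ) → M) :
    ∑ σ, f σ = ∑ σ : Fin n → ℤˣ,
      (f (k.insertNth (α := fun _ => ℤˣ) τ σ) + f (k.insertNth (α := fun _ => ℤˣ) (-τ) σ)) := by
  rw [← (Fin.insertNthEquiv (fun _ => ℤˣ) k).sum_comp, Fintype.sum_prod_type, Finset.sum_comm]
  refine Finset.sum_congr rfl fun σ _ => ?_
  rw [UnitsInt.univ, Finset.sum_pair (by decide)]
  rcases Int.units_eq_one_or τ with rfl | rfl
  · rfl
  · rw [add_comm, neg_neg]; rfl

variable {K : Type*} [Field K]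

/-- The point with coordinates `xᵢ ^ σᵢ`. -/
def signedPoint {n : ℕ} (x : Fin n → K) (σ : Fin n → ℤˣ) : Fin n → K :=
  fun i => x i ^ ((σ i : ℤˣ) : ℤ)

/-- The product over the roots `2εᵢ` and `εᵢ + εⱼ` of `(1 - t y^α) / (1 - y^α)`. -/
def rootWeight (t : K) {n : ℕ} (y : Fin n → K) : K :=
  (∏ i, (1 - t * y i ^ 2) / (1 - y i ^ 2)) *
    ∏ i, ∏ j ∈ Finset.Ioi i, (1 - t * (y i * y j)) / (1 - y i * y j)

/-- The polynomial function `∏ᵢ (1 - aᵢ v) (1 - bᵢ v)`. -/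
def linProd {R : Type*} [CommRing R] {n : ℕ} (a b : Fin n → R) (v : R) : R :=
  ∏ i, ((1 - a i * v) * (1 - b i * v))

/-- `linProd` as a polynomial. -/
noncomputable def linProdPoly {n : ℕ} (a b : Fin n → K) : K[X] :=
  linProd (fun i => C (a i)) (fun i => C (b i)) X

lemma eval_linProdPoly {n : ℕ} (a b : Fin n → K) (v : K) :
    (linProdPoly a b).eval v = linProd a b v := by
  simp [linProdPoly, linProd, eval_prod]

lemma natDegree_linProdPoly_le {n : ℕ} (a b : Fin n → K) :
    (linProdPoly a b).natDegree ≤ 2 * n := by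
  have h1 : ∀ c : K, (1 - C c * X : K[X]).natDegree ≤ 1 := by
    intro c
    refine (natDegree_sub_le _ _).trans ?_
    simpa using (natDegree_C_mul_le c X).trans natDegree_X_le
  unfold linProdPoly linProd
  refine (natDegree_prod_le _ _).trans ((Finset.sum_le_card_nsmul _ _ 2 fun i _ => ?_).trans ?_)
  · exact natDegree_mul_le.trans (Nat.add_le_add (h1 _) (h1 _))
  · simp [mul_comm]

/-- Genericity of a point of the torus: the values `xᵢ ^ ±1` are pairwise distinct, and unless
`t = 1` no product of two of them equals `t⁻¹`. -/
structure GenericPoint (t : K) {n : ℕ} (x : Fin n → K) : Prop where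
  t_ne : t ≠ 0
  ne_zero : ∀ i, x i ≠ 0
  inj : Function.Injective fun p : Fin n × ℤˣ => x p.1 ^ ((p.2 : ℤˣ) : ℤ)
  res : t = 1 ∨ ∀ i j (σ τ : ℤˣ), t * x i ^ (σ : ℤ) * x j ^ (τ : ℤ) ≠ 1

lemma GenericPoint.comp {t : K} {m n : ℕ} {x : Fin n → K} (h : GenericPoint t x) {e : Fin m → Fin n}
    (he : Function.Injective e) : GenericPoint t (x ∘ e) where
  t_ne := h.t_ne
  ne_zero i := h.ne_zero _
  inj p p' hp := by
    have := @h.inj (e p.1, p.2) (e p'.1, p'.2) hp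
    simp only [Prod.mk.injEq] at this
    exact Prod.ext (he this.1) this.2
  res := h.res.imp id fun h i j σ τ => h _ _ σ τ

lemma GenericPoint.signed_ne_zero {t : K} {n : ℕ} {x : Fin n → K} (h : GenericPoint t x)
    (σ : Fin n → ℤˣ) (i : Fin n) : signedPoint x σ i ≠ 0 :=
  zpow_ne_zero _ (h.ne_zero i)

lemma GenericPoint.one_sub_ne_zero {t : K} {n : ℕ} {x : Fin n → K} (h : GenericPoint t x)
    (σ : Fin n → ℤˣ) (i j : Fin n) : 1 - signedPoint x σ i * signedPoint x σ j ≠ 0 := by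
  intro h0
  have h1 : x i ^ ((σ i : ℤˣ) : ℤ) = x j ^ ((-σ j : ℤˣ) : ℤ) := by
    rw [Units.val_neg, zpow_neg]
    exact eq_inv_of_mul_eq_one_left (sub_eq_zero.mp h0).symm
  have h2 := @h.inj (i, σ i) (j, -σ j) h1
  simp only [Prod.mk.injEq] at h2
  obtain ⟨rfl, h2⟩ := h2
  rcases Int.units_eq_one_or (σ i) with h3 | h3 <;> rw [h3] at h2 <;> exact absurd h2 (by decide)

/-- Inverting a coordinate swaps its two factors. Hence such products can be taken out of the sum
over signs. -/
lemma linProd_inv_pair {n : ℕ} (c : K) (x : Fin n → K) (σ : Fin n → ℤˣ) (v : K) :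
    linProd (fun i => c * signedPoint x σ i) (fun i => c * (signedPoint x σ i)⁻¹) v =
      linProd (fun i => c * x i) (fun i => c * (x i)⁻¹) v := by
  refine Finset.prod_congr rfl fun i _ => ?_
  rcases Int.units_eq_one_or (σ i) with h | h <;> simp [signedPoint, h]
  ring

lemma rootWeight_succAbove (t : K) {n : ℕ} (y : Fin (n + 1) → K) (k : Fin (n + 1)) :
    rootWeight t y = (1 - t * y k ^ 2) / (1 - y k ^ 2) *
      (∏ j, (1 - t * (y k * y (k.succAbove j))) / (1 - y k * y (k.succAbove j))) *
        rootWeight t (y ∘ k.succAbove) := by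
  rw [rootWeight, rootWeight, Fin.prod_univ_succAbove _ k,
    prod_pairs_succAbove _ (fun i j => by rw [mul_comm (y i)]) k]
  simp only [Function.comp]
  ring

lemma linProd_succAbove {R : Type*} [CommRing R] {n : ℕ} (a b : Fin (n + 1) → R)
    (k : Fin (n + 1)) (v : R) :
    linProd a b v = (1 - a k * v) * (1 - b k * v) *
      linProd (a ∘ k.succAbove) (b ∘ k.succAbove) v :=
  Fin.prod_univ_succAbove _ k

/-- At `v = y k` the factors `1 - y j * v` are exactly the denominators of the weight that involve
`k`. They cancel, and the weight of the other coordinates remains. -/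
lemma rootWeight_mul_linProd_self (t : K) {n : ℕ} (y : Fin (n + 1) → K) (k : Fin (n + 1))
    (h1 : ∀ i j, 1 - y i * y j ≠ 0) :
    rootWeight t y * linProd y (fun i => t * (y i)⁻¹) (y k) =
      linProd (fun i => t * y i) (fun i => t * (y i)⁻¹) (y k) *
        rootWeight t (y ∘ k.succAbove) := by
  rw [rootWeight_succAbove t y k, linProd_succAbove _ _ k, linProd_succAbove _ _ k]
  have h2 : (∏ j, (1 - t * (y k * y (k.succAbove j))) / (1 - y k * y (k.succAbove j))) *
      linProd (y ∘ k.succAbove) ((fun i => t * (y i)⁻¹) ∘ k.succAbove) (y k) =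
      linProd ((fun i => t * y i) ∘ k.succAbove) ((fun i => t * (y i)⁻¹) ∘ k.succAbove) (y k) := by
    rw [linProd, linProd, ← Finset.prod_mul_distrib]
    refine Finset.prod_congr rfl fun j _ => ?_
    have := h1 k (k.succAbove j)
    simp only [Function.comp]
    rw [show 1 - y (k.succAbove j) * y k = 1 - y k * y (k.succAbove j) by ring]
    rw [← mul_assoc, div_mul_cancel₀ _ this]
    ring
  have h3 : (1 - t * y k ^ 2) / (1 - y k ^ 2) * (1 - y k * y k) = 1 - t * y k * y k := by
    rw [← pow_two, div_mul_cancel₀ _ (by rw [pow_two]; exact h1 k k)]; ring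
  rw [← h2, ← h3]
  ring

/-- For `v = (t * y k)⁻¹` the factors `1 - t * (y j)⁻¹ * v` cancel the denominators that involve
`k`, up to monomials, and the numerators `1 - t * (y k * y j)` turn into `t * (1 - (y j)⁻¹ * v)` up
to the same monomials. -/
lemma rootWeight_mul_linProd_residue (t : K) {n : ℕ} (y : Fin (n + 1) → K) (k : Fin (n + 1))
    (h0 : ∀ i, y i ≠ 0) (h1 : ∀ i j, 1 - y i * y j ≠ 0) {v : K} (hv : t * y k * v = 1) :
    rootWeight t y * linProd y (fun i => t * (y i)⁻¹) v =
      t ^ (n + 1) * linProd y (fun i => (y i)⁻¹) v * rootWeight t (y ∘ k.succAbove) := by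
  rw [rootWeight_succAbove t y k, linProd_succAbove _ _ k, linProd_succAbove _ _ k]
  have ht : t ≠ 0 := by rintro rfl; simp at hv
  have hv' : v = (t * y k)⁻¹ := eq_inv_of_mul_eq_one_right hv
  have h2 : (∏ j, (1 - t * (y k * y (k.succAbove j))) / (1 - y k * y (k.succAbove j))) *
      linProd (y ∘ k.succAbove) ((fun i => t * (y i)⁻¹) ∘ k.succAbove) v =
      t ^ n * linProd (y ∘ k.succAbove) ((fun i => (y i)⁻¹) ∘ k.succAbove) v := by
    rw [linProd, linProd, ← Finset.prod_mul_distrib]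
    have : t ^ n = ∏ _j : Fin n, t := by simp
    rw [this, ← Finset.prod_mul_distrib]
    refine Finset.prod_congr rfl fun j _ => ?_
    have h3 := h1 k (k.succAbove j)
    have h4 := h0 k
    have h5 := h0 (k.succAbove j)
    simp only [Function.comp]
    have h6 : 1 - t * (y (k.succAbove j))⁻¹ * v =
        -(1 - y k * y (k.succAbove j)) / (y k * y (k.succAbove j)) := by
      rw [hv']; field_simp; ring
    have h7 : t * (1 - (y (k.succAbove j))⁻¹ * v) =
        -(1 - t * (y k * y (k.succAbove j))) / (y k * y (k.succAbove j)) := by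
      rw [hv']; field_simp; ring
    rw [h6, mul_left_comm t (1 - y (k.succAbove j) * v), h7]
    field_simp
  have h3 : (1 - t * y k ^ 2) / (1 - y k ^ 2) * ((1 - y k * v) * (1 - t * (y k)⁻¹ * v)) =
      t * ((1 - y k * v) * (1 - (y k)⁻¹ * v)) := by
    have h3 : 1 - y k ^ 2 ≠ 0 := by rw [pow_two]; exact h1 k k
    have h4 := h0 k
    have h6 : 1 - t * (y k)⁻¹ * v = -(1 - y k ^ 2) / (y k ^ 2) := by
      rw [hv']; field_simp; ring
    have h7 : t * (1 - (y k)⁻¹ * v) = -(1 - t * y k ^ 2) / y k ^ 2 := by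
      rw [hv']; field_simp; ring
    rw [h6, mul_left_comm t (1 - y k * v), h7]
    field_simp
  calc _ = ((1 - t * y k ^ 2) / (1 - y k ^ 2) * ((1 - y k * v) * (1 - t * (y k)⁻¹ * v))) *
        ((∏ j, (1 - t * (y k * y (k.succAbove j))) / (1 - y k * y (k.succAbove j))) *
      linProd (y ∘ k.succAbove) ((fun i => t * (y i)⁻¹) ∘ k.succAbove) v) *
        rootWeight t (y ∘ k.succAbove) := by ring
    _ = _ := by rw [h2, h3]; ring

lemma signedPoint_insertNth_self {n : ℕ} (x : Fin (n + 1) → K) (k : Fin (n + 1)) (τ : ℤˣ)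
    (σ : Fin n → ℤˣ) :
    signedPoint x (k.insertNth (α := fun _ => ℤˣ) τ σ) k = x k ^ (τ : ℤ) := by
  simp [signedPoint]

lemma signedPoint_insertNth_comp {n : ℕ} (x : Fin (n + 1) → K) (k : Fin (n + 1)) (τ : ℤˣ)
    (σ : Fin n → ℤˣ) :
    signedPoint x (k.insertNth (α := fun _ => ℤˣ) τ σ) ∘ k.succAbove =
      signedPoint (x ∘ k.succAbove) σ := by
  ext; simp [signedPoint]

lemma linProd_inv_pair_one {n : ℕ} (x : Fin n → K) (σ : Fin n → ℤˣ) (v : K) :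
    linProd (signedPoint x σ) (fun i => (signedPoint x σ i)⁻¹) v =
      linProd x (fun i => (x i)⁻¹) v := by
  simpa using linProd_inv_pair 1 x σ v

/-- The product `∏_{i=1}^n (tⁱ + 1)`. -/
def onePlusPowers {R : Type*} [CommRing R] (t : R) (n : ℕ) : R :=
  ∏ i ∈ Finset.range n, (t ^ (i + 1) + 1)

lemma linProd_at_coord {n : ℕ} {x : Fin n → K} (hx : ∀ i, x i ≠ 0) (k : Fin n) (τ : ℤˣ) :
    linProd x (fun i => (x i)⁻¹) (x k ^ (τ : ℤ)) = 0 := by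
  refine Finset.prod_eq_zero (Finset.mem_univ k) ?_
  rcases Int.units_eq_one_or τ with h | h <;> simp [h, hx k]

/-- A sign `-τ` at `k` makes the factor `1 - y k * v` vanish; for sign `τ` the poles cancel. The
spare function `g` carries the second `linProd` in the two-variable sum. -/
lemma GenericPoint.sum_at_coord {t : K} {n : ℕ} {x : Fin (n + 1) → K} (h : GenericPoint t x)
    (k : Fin (n + 1)) (τ : ℤˣ) (g : (Fin (n + 1) → K) → K) :
    ∑ σ, rootWeight t (signedPoint x σ) *
        linProd (signedPoint x σ) (fun i => t * (signedPoint x σ i)⁻¹) (x k ^ (τ : ℤ)) *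
          g (signedPoint x σ) =
      linProd (fun i => t * x i) (fun i => t * (x i)⁻¹) (x k ^ (τ : ℤ)) *
        ∑ σ, rootWeight t (signedPoint (x ∘ k.succAbove) σ) *
          g (signedPoint x (k.insertNth (α := fun _ => ℤˣ) τ σ)) := by
  rw [sum_signs_insertNth k τ, Finset.mul_sum]
  refine Finset.sum_congr rfl fun σ _ => ?_
  have h1 := rootWeight_mul_linProd_self t
    (signedPoint x (k.insertNth (α := fun _ => ℤˣ) τ σ)) k (h.one_sub_ne_zero _)
  rw [signedPoint_insertNth_self, signedPoint_insertNth_comp, linProd_inv_pair] at h1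
  have h2 : linProd (signedPoint x (k.insertNth (α := fun _ => ℤˣ) (-τ) σ))
      (fun i => t * (signedPoint x (k.insertNth (α := fun _ => ℤˣ) (-τ) σ) i)⁻¹)
      (x k ^ (τ : ℤ)) = 0 := by
    refine Finset.prod_eq_zero (Finset.mem_univ k) ?_
    rw [signedPoint_insertNth_self, Units.val_neg, zpow_neg,
      inv_mul_cancel₀ (zpow_ne_zero _ (h.ne_zero k)), sub_self, zero_mul]
  rw [h1, h2]
  ring

/-- Supplies the one interpolation node that is needed besides the points `x k ^ ±1`. Sign `-1` at
`k` is killed by the factor `1 - t * (y k)⁻¹ * v`. -/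
lemma GenericPoint.sum_residue {t : K} {n : ℕ} {x : Fin (n + 1) → K} (h : GenericPoint t x)
    (k : Fin (n + 1)) {v : K} (hv : t * x k * v = 1) :
    ∑ σ, rootWeight t (signedPoint x σ) *
        linProd (signedPoint x σ) (fun i => t * (signedPoint x σ i)⁻¹) v =
      t ^ (n + 1) * linProd x (fun i => (x i)⁻¹) v *
        ∑ σ, rootWeight t (signedPoint (x ∘ k.succAbove) σ) := by
  rw [sum_signs_insertNth k 1, Finset.mul_sum]
  refine Finset.sum_congr rfl fun σ _ => ?_
  have h1 := rootWeight_mul_linProd_residue t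
    (signedPoint x (k.insertNth (α := fun _ => ℤˣ) 1 σ)) k (h.signed_ne_zero _)
    (h.one_sub_ne_zero _) (v := v) (by rw [signedPoint_insertNth_self]; simpa using hv)
  rw [signedPoint_insertNth_comp, linProd_inv_pair_one] at h1
  have h2 : linProd (signedPoint x (k.insertNth (α := fun _ => ℤˣ) (-1) σ))
      (fun i => t * (signedPoint x (k.insertNth (α := fun _ => ℤˣ) (-1) σ) i)⁻¹) v = 0 := by
    refine Finset.prod_eq_zero (Finset.mem_univ k) ?_
    have h3 : signedPoint x (k.insertNth (α := fun _ => ℤˣ) (-1) σ) k = (x k)⁻¹ := by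
      rw [signedPoint_insertNth_self]; simp
    simp only [h3, inv_inv, hv, sub_self, mul_zero]
  rw [h1, h2]
  ring

lemma rootWeight_one {n : ℕ} {y : Fin n → K} (h1 : ∀ i j, 1 - y i * y j ≠ 0) :
    rootWeight 1 y = 1 := by
  have h2 : ∀ i, 1 - y i ^ 2 ≠ 0 := fun i => by rw [pow_two]; exact h1 i i
  simp [rootWeight, h1, h2]

/-- Both sides have degree at most 2(n+1) in `v` and agree at the 2(n+1) points `x k ^ ±1` and at
`(t * x 0)⁻¹`. At each node the sum reduces to the constant sum in `n` variables, which is the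
hypothesis `ih`. -/
lemma sum_rootWeight_mul_linProd_of_sum {t : K} {n : ℕ}
    (ih : ∀ x : Fin n → K, GenericPoint t x →
      ∑ σ, rootWeight t (signedPoint x σ) = onePlusPowers t n)
    {x : Fin (n + 1) → K} (h : GenericPoint t x) (v : K) :
    ∑ σ, rootWeight t (signedPoint x σ) *
        linProd (signedPoint x σ) (fun i => t * (signedPoint x σ i)⁻¹) v =
      onePlusPowers t n * (linProd (fun i => t * x i) (fun i => t * (x i)⁻¹) v +
        t ^ (n + 1) * linProd x (fun i => (x i)⁻¹) v) := by
  -- For `t = 1` the extra node coincides with `(x 0)⁻¹`, but then every weight is 1 and the claim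
  -- is immediate.
  rcases h.res with rfl | hres
  · simp only [rootWeight_one (h.one_sub_ne_zero _), one_mul, linProd_inv_pair_one]
    simp [onePlusPowers, ← two_mul, pow_succ, mul_assoc]
  set P : K[X] := (∑ σ, C (rootWeight t (signedPoint x σ)) *
      linProdPoly (signedPoint x σ) (fun i => t * (signedPoint x σ i)⁻¹)) -
    C (onePlusPowers t n) * (linProdPoly (fun i => t * x i) (fun i => t * (x i)⁻¹) +
      C (t ^ (n + 1)) * linProdPoly x (fun i => (x i)⁻¹)) with hP
  have heval : ∀ v, P.eval v = (∑ σ, rootWeight t (signedPoint x σ) *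
        linProd (signedPoint x σ) (fun i => t * (signedPoint x σ i)⁻¹) v) -
      onePlusPowers t n * (linProd (fun i => t * x i) (fun i => t * (x i)⁻¹) v +
        t ^ (n + 1) * linProd x (fun i => (x i)⁻¹) v) := by
    intro v
    simp [hP, eval_finsetSum, eval_linProdPoly]
  have hdeg : P.natDegree ≤ 2 * (n + 1) := by
    refine (natDegree_sub_le _ _).trans (max_le ?_ ?_)
    · exact natDegree_sum_le_of_forall_le _ _ fun σ _ =>
        (natDegree_C_mul_le _ _).trans (natDegree_linProdPoly_le _ _)
    · refine (natDegree_C_mul_le _ _).trans ((natDegree_add_le _ _).trans (max_le ?_ ?_))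
      · exact natDegree_linProdPoly_le _ _
      · exact (natDegree_C_mul_le _ _).trans (natDegree_linProdPoly_le _ _)
  have hx0 : t * x 0 * (t * x 0)⁻¹ = 1 := mul_inv_cancel₀ (mul_ne_zero h.t_ne (h.ne_zero 0))
  have hzero : P = 0 := by
    refine eq_zero_of_natDegree_lt_card_of_eval_eq_zero P
      (f := fun o : Option (Fin (n + 1) × ℤˣ) => o.elim (t * x 0)⁻¹
        fun p => x p.1 ^ ((p.2 : ℤˣ) : ℤ)) ?_ ?_ ?_
    · have hne : ∀ p : Fin (n + 1) × ℤˣ, (t * x 0)⁻¹ ≠ x p.1 ^ ((p.2 : ℤˣ) : ℤ) := by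
        intro p hp
        refine hres 0 p.1 1 p.2 ?_
        rw [← hp]
        simpa using hx0
      rintro (_ | p) (_ | p') hp
      · rfl
      · exact absurd hp (hne p')
      · exact absurd hp.symm (hne p)
      · exact congrArg some (h.inj hp)
    · rintro (_ | ⟨k, τ⟩)
      · simp only [Option.elim, heval]
        rw [h.sum_residue 0 hx0, ih _ (h.comp (Fin.succAbove_right_injective))]
        have : linProd (fun i => t * x i) (fun i => t * (x i)⁻¹) (t * x 0)⁻¹ = 0 := by
          refine Finset.prod_eq_zero (Finset.mem_univ 0) ?_
          rw [hx0, sub_self, zero_mul]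
        rw [this]
        ring
      · simp only [Option.elim, heval]
        have := h.sum_at_coord k τ fun _ => 1
        simp only [mul_one] at this
        rw [this, ih _ (h.comp (Fin.succAbove_right_injective)), linProd_at_coord h.ne_zero]
        ring
    · refine hdeg.trans_lt ?_
      simp only [Fintype.card_option, Fintype.card_prod, Fintype.card_fin, Fintype.card_units_int]
      omega
  have := heval v
  rw [hzero, eval_zero] at this
  exact sub_eq_zero.mp this.symm

lemma linProd_zero {R : Type*} [CommRing R] {n : ℕ} (a b : Fin n → R) : linProd a b 0 = 1 := by
  simp [linProd]

/-- At `v = 0` the one-variable formula reads S_{n+1} = S_n (1 + t^{n+1}). -/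
theorem GenericPoint.sum_rootWeight {t : K} : ∀ {n : ℕ} {x : Fin n → K}, GenericPoint t x →
    ∑ σ, rootWeight t (signedPoint x σ) = onePlusPowers t n
  | 0, x, _ => by simp [rootWeight, onePlusPowers]
  | n + 1, x, h => by
    have := sum_rootWeight_mul_linProd_of_sum (fun _ h => GenericPoint.sum_rootWeight h) h 0
    simp only [linProd_zero, mul_one] at this
    rw [this, onePlusPowers, onePlusPowers, Finset.prod_range_succ]
    ring

theorem GenericPoint.sum_rootWeight_mul_linProd {t : K} {n : ℕ} {x : Fin (n + 1) → K}
    (h : GenericPoint t x) (v : K) :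
    ∑ σ, rootWeight t (signedPoint x σ) *
        linProd (signedPoint x σ) (fun i => t * (signedPoint x σ i)⁻¹) v =
      onePlusPowers t n * (linProd (fun i => t * x i) (fun i => t * (x i)⁻¹) v +
        t ^ (n + 1) * linProd x (fun i => (x i)⁻¹) v) :=
  sum_rootWeight_mul_linProd_of_sum (fun _ h => h.sum_rootWeight) h v

/-- Factor by factor: 1 - x/w is a monomial times 1 - w/x, and t - x/w is the same monomial times 1
- tw/x. It serves the node at which the prefactor 1 - tvw vanishes. -/
lemma linProd_at_reflection {t : K} (ht : t ≠ 0) {n : ℕ} {x : Fin n → K} (hx : ∀ i, x i ≠ 0)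
    {w : K} (hw : w ≠ 0) :
    linProd (fun i => t * x i) (fun i => t * (x i)⁻¹) (t * w)⁻¹ *
        linProd (fun i => t * x i) (fun i => t * (x i)⁻¹) w =
      t ^ (2 * n) * (linProd x (fun i => (x i)⁻¹) (t * w)⁻¹ * linProd x (fun i => (x i)⁻¹) w) := by
  have h1 : t ^ (2 * n) = ∏ _i : Fin n, t ^ 2 := by simp [pow_mul]
  rw [h1]
  simp only [linProd, ← Finset.prod_mul_distrib]
  refine Finset.prod_congr rfl fun i _ => ?_
  have := hx i
  field_simp
  ring

/-- The right-hand side of the two-variable summation formula. -/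
def pairSum {R : Type*} [CommRing R] (t : R) (m : ℕ) (v w Dv Dw Bv Bw : R) : R :=
  onePlusPowers t m * ((v - w) * (1 - v * w) * (Dv * Dw) +
    t ^ (m + 1) * (1 - t * v * w) * ((t * v - w) * (Bv * Dw) - (t * w - v) * (Dv * Bw)) +
    t ^ (2 * m + 3) * (v - w) * (1 - t ^ 2 * v * w) * (Bv * Bw))

/-- At this node only the sign `τ` at `k` survives. The factor of the second product at `k` is then
constant and comes out, which leaves the one-variable sum in `m + 1` coordinates. On the right, the
terms with `linProd x` at the node drop out. -/
lemma GenericPoint.pair_at_coord {t : K} {m : ℕ} {x : Fin (m + 2) → K} (h : GenericPoint t x)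
    (k : Fin (m + 2)) (τ : ℤˣ) (w : K) :
    (x k ^ (τ : ℤ) - w) * (1 - t * x k ^ (τ : ℤ) * w) *
      ∑ σ, rootWeight t (signedPoint x σ) *
        linProd (signedPoint x σ) (fun i => t * (signedPoint x σ i)⁻¹) (x k ^ (τ : ℤ)) *
        linProd (signedPoint x σ) (fun i => t * (signedPoint x σ i)⁻¹) w =
    pairSum t m (x k ^ (τ : ℤ)) w
      (linProd (fun i => t * x i) (fun i => t * (x i)⁻¹) (x k ^ (τ : ℤ)))
      (linProd (fun i => t * x i) (fun i => t * (x i)⁻¹) w)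
      (linProd x (fun i => (x i)⁻¹) (x k ^ (τ : ℤ))) (linProd x (fun i => (x i)⁻¹) w) := by
  have h1 := h.sum_at_coord k τ fun y => linProd y (fun i => t * (y i)⁻¹) w
  rw [h1, pairSum, linProd_at_coord h.ne_zero]
  set v := x k ^ (τ : ℤ) with hv
  have hv0 : v ≠ 0 := zpow_ne_zero _ (h.ne_zero k)
  have h2 : ∀ σ : Fin (m + 1) → ℤˣ,
      linProd (signedPoint x (k.insertNth (α := fun _ => ℤˣ) τ σ))
        (fun i => t * (signedPoint x (k.insertNth (α := fun _ => ℤˣ) τ σ) i)⁻¹) w =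
      (1 - v * w) * (1 - t * v⁻¹ * w) * linProd (signedPoint (x ∘ k.succAbove) σ)
        (fun i => t * (signedPoint (x ∘ k.succAbove) σ i)⁻¹) w := by
    intro σ
    rw [linProd_succAbove _ _ k, signedPoint_insertNth_self, signedPoint_insertNth_comp, ← hv]
    congr 2
    ext i
    rw [← signedPoint_insertNth_comp x k τ]
    rfl
  have h3 : ∑ σ : Fin (m + 1) → ℤˣ, rootWeight t (signedPoint (x ∘ k.succAbove) σ) *
      linProd (signedPoint x (k.insertNth (α := fun _ => ℤˣ) τ σ))
        (fun i => t * (signedPoint x (k.insertNth (α := fun _ => ℤˣ) τ σ) i)⁻¹) w =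
      (1 - v * w) * (1 - t * v⁻¹ * w) * (onePlusPowers t m *
        (linProd ((fun i => t * x i) ∘ k.succAbove) ((fun i => t * (x i)⁻¹) ∘ k.succAbove) w +
        t ^ (m + 1) * linProd (x ∘ k.succAbove) ((fun i => (x i)⁻¹) ∘ k.succAbove) w)) := by
    have := (h.comp (k.succAbove_right_injective)).sum_rootWeight_mul_linProd w
    simp only [Function.comp_def] at this ⊢
    rw [← this, Finset.mul_sum]
    refine Finset.sum_congr rfl fun σ _ => ?_
    rw [h2]
    simp only [Function.comp_def]
    ring
  rw [h3, linProd_succAbove (fun i => t * x i) _ k w, linProd_succAbove x _ k w]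
  have h4 : (1 - t * x k * w) * (1 - t * (x k)⁻¹ * w) =
      (1 - t * v * w) * (1 - t * v⁻¹ * w) := by
    rcases Int.units_eq_one_or τ with h | h <;> simp [hv, h]
    ring
  have h5 : (1 - x k * w) * (1 - (x k)⁻¹ * w) = (1 - v * w) * (1 - v⁻¹ * w) := by
    rcases Int.units_eq_one_or τ with h | h <;> simp [hv, h]
    ring
  rw [h4, h5]
  field_simp
  ring

/-- Interpolation in `v` with `w` fixed: degree at most 2(m+2) + 2, and nodes 0, `w`, `(t * w)⁻¹`
and the 2(m+2) points `x k ^ ±1`. The conditions on `w` say that the nodes are distinct. -/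
theorem GenericPoint.sum_rootWeight_mul_linProd_mul_linProd {t : K} {m : ℕ} {x : Fin (m + 2) → K}
    (h : GenericPoint t x) {w : K} (hw0 : w ≠ 0) (hww : t * w * w ≠ 1)
    (hwx : ∀ k (τ : ℤˣ), w ≠ x k ^ (τ : ℤ)) (htwx : ∀ k (τ : ℤˣ), t * w * x k ^ (τ : ℤ) ≠ 1)
    (v : K) :
    (v - w) * (1 - t * v * w) * ∑ σ, rootWeight t (signedPoint x σ) *
        linProd (signedPoint x σ) (fun i => t * (signedPoint x σ i)⁻¹) v *
        linProd (signedPoint x σ) (fun i => t * (signedPoint x σ i)⁻¹) w =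
    pairSum t m v w
      (linProd (fun i => t * x i) (fun i => t * (x i)⁻¹) v)
      (linProd (fun i => t * x i) (fun i => t * (x i)⁻¹) w)
      (linProd x (fun i => (x i)⁻¹) v) (linProd x (fun i => (x i)⁻¹) w) := by
  set Q : K[X] := ∑ σ, C (rootWeight t (signedPoint x σ) *
      linProd (signedPoint x σ) (fun i => t * (signedPoint x σ i)⁻¹) w) *
      linProdPoly (signedPoint x σ) (fun i => t * (signedPoint x σ i)⁻¹) with hQ
  set D : K[X] := linProdPoly (fun i => t * x i) (fun i => t * (x i)⁻¹) with hD
  set B : K[X] := linProdPoly x (fun i => (x i)⁻¹) with hB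
  set dw := linProd (fun i => t * x i) (fun i => t * (x i)⁻¹) w with hdw
  set bw := linProd x (fun i => (x i)⁻¹) w with hbw
  set P : K[X] := (X - C w) * (1 - C (t * w) * X) * Q -
    C (onePlusPowers t m) * ((X - C w) * (1 - C w * X) * (C dw * D) +
    C (t ^ (m + 1)) * (1 - C (t * w) * X) *
      ((C t * X - C w) * (C dw * B) - (C (t * w) - X) * (C bw * D)) +
    C (t ^ (2 * m + 3)) * (X - C w) * (1 - C (t ^ 2 * w) * X) * (C bw * B)) with hP
  have heval : ∀ v, P.eval v = (v - w) * (1 - t * v * w) *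
      (∑ σ, rootWeight t (signedPoint x σ) *
        linProd (signedPoint x σ) (fun i => t * (signedPoint x σ i)⁻¹) v *
        linProd (signedPoint x σ) (fun i => t * (signedPoint x σ i)⁻¹) w) -
      pairSum t m v w (linProd (fun i => t * x i) (fun i => t * (x i)⁻¹) v) dw
        (linProd x (fun i => (x i)⁻¹) v) bw := by
    intro v
    have : Q.eval v = ∑ σ, rootWeight t (signedPoint x σ) *
        linProd (signedPoint x σ) (fun i => t * (signedPoint x σ i)⁻¹) v *
        linProd (signedPoint x σ) (fun i => t * (signedPoint x σ i)⁻¹) w := by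
      simp only [hQ, eval_finsetSum, eval_mul, eval_C, eval_linProdPoly]
      exact Finset.sum_congr rfl fun _ _ => by ring
    rw [← this]
    simp only [hP, pairSum, eval_sub, eval_mul, eval_add, eval_C, eval_X, eval_one, hD, hB,
      eval_linProdPoly]
    ring
  have hlin : ∀ a b : K, (C a * X + C b : K[X]).natDegree ≤ 1 := fun a b => natDegree_linear_le
  have l1 : (X - C w : K[X]).natDegree ≤ 1 := natDegree_X_sub_C_le w
  have l2 : ∀ c : K, (1 - C c * X : K[X]).natDegree ≤ 1 := fun c => by
    have := hlin (-c) 1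
    simpa [sub_eq_add_neg, add_comm] using this
  have l3 : (C t * X - C w : K[X]).natDegree ≤ 1 := by
    simpa [sub_eq_add_neg] using hlin t (-w)
  have l4 : (C (t * w) - X : K[X]).natDegree ≤ 1 := by
    simpa [sub_eq_add_neg, add_comm] using hlin (-1) (t * w)
  have lD : D.natDegree ≤ 2 * (m + 2) := natDegree_linProdPoly_le _ _
  have lB : B.natDegree ≤ 2 * (m + 2) := natDegree_linProdPoly_le _ _
  have lQ : Q.natDegree ≤ 2 * (m + 2) := natDegree_sum_le_of_forall_le _ _ fun σ _ =>
        (natDegree_C_mul_le _ _).trans (natDegree_linProdPoly_le _ _)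
  have hmul : ∀ {p q : K[X]} {a b : ℕ}, p.natDegree ≤ a → q.natDegree ≤ b →
      (p * q).natDegree ≤ a + b := fun h h' => natDegree_mul_le_of_le h h'
  have hC : ∀ {q : K[X]} {b : ℕ} (c : K), q.natDegree ≤ b →
      (C c * q).natDegree ≤ b := fun c h => (natDegree_C_mul_le _ _).trans h
  have hdeg : P.natDegree ≤ 2 * (m + 2) + 2 := by
    refine (natDegree_sub_le _ _).trans (max_le ?_ (hC _ ?_))
    · exact (hmul (hmul l1 (l2 _)) lQ).trans (by omega)
    refine natDegree_add_le_of_degree_le (natDegree_add_le_of_degree_le ?_ ?_) ?_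
    · exact (hmul (hmul l1 (l2 _)) (hC _ lD)).trans (by omega)
    · refine (hmul (hC _ (l2 _)) (b := 2 * (m + 2) + 1) ?_).trans (by omega)
      refine (natDegree_sub_le _ _).trans (max_le ?_ ?_)
      · exact (hmul l3 (hC _ lB)).trans (by omega)
      · exact (hmul l4 (hC _ lD)).trans (by omega)
    · exact (hmul (hmul (hC _ l1) (l2 _)) (hC _ lB)).trans (by omega)
  have ht := h.t_ne
  have htw : t * w * (t * w)⁻¹ = 1 := mul_inv_cancel₀ (mul_ne_zero ht hw0)
  -- At `v = 0` the first product is 1, and the one-variable formula in `w` applies.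
  have e0 : P.eval 0 = 0 := by
    rw [heval]
    have h1 := h.sum_rootWeight_mul_linProd w
    simp only [linProd_zero, mul_one, pairSum]
    rw [h1, onePlusPowers, onePlusPowers, Finset.prod_range_succ]
    ring
  have ew : P.eval w = 0 := by
    rw [heval, pairSum]; ring
  -- The left side vanishes with `1 - t * v * w`; on the right the reflection makes the two
  -- remaining terms cancel.
  have ei : P.eval (t * w)⁻¹ = 0 := by
    have h1 := linProd_at_reflection ht h.ne_zero hw0
    rw [← hdw, ← hbw] at h1
    rw [heval, pairSum, h1]
    have h2 : t * (t * w)⁻¹ * w = 1 := by rw [← htw]; ring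
    have h3 : (t * w)⁻¹ * w = t⁻¹ := by field_simp
    rw [mul_assoc (t ^ 2), h3, h2]
    field_simp
    ring
  have hzero : P = 0 := by
    refine eq_zero_of_natDegree_lt_card_of_eval_eq_zero P
      (f := fun o : Option (Option (Option (Fin (m + 2) × ℤˣ))) => o.elim 0 fun o =>
        o.elim w fun o => o.elim (t * w)⁻¹ fun p => x p.1 ^ ((p.2 : ℤˣ) : ℤ)) ?_ ?_ ?_
    · have a1 : (t * w)⁻¹ ≠ 0 := inv_ne_zero (mul_ne_zero ht hw0)
      have a2 : w ≠ (t * w)⁻¹ := fun h => hww (by rw [← htw, ← h])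
      have a3 : ∀ k (τ : ℤˣ), (t * w)⁻¹ ≠ x k ^ (τ : ℤ) := fun k τ h =>
        htwx k τ (by rw [← h, htw])
      have a4 : ∀ k (τ : ℤˣ), x k ^ (τ : ℤ) ≠ 0 := fun k τ => zpow_ne_zero _ (h.ne_zero k)
      rintro (_ | _ | _ | p) (_ | _ | _ | p') hp
      · rfl
      · exact absurd hp.symm hw0
      · exact absurd hp.symm a1
      · exact absurd hp.symm (a4 _ _)
      · exact absurd hp hw0
      · rfl
      · exact absurd hp a2
      · exact absurd hp (hwx _ _)
      · exact absurd hp a1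
      · exact absurd hp.symm a2
      · rfl
      · exact absurd hp (a3 _ _)
      · exact absurd hp (a4 _ _)
      · exact absurd hp.symm (hwx _ _)
      · exact absurd hp.symm (a3 _ _)
      · exact congrArg (fun p => some (some (some p))) (h.inj hp)
    · rintro (_ | _ | _ | ⟨k, τ⟩)
      · exact e0
      · exact ew
      · exact ei
      · refine (heval _).trans (sub_eq_zero.mpr ?_)
        exact h.pair_at_coord k τ w
    · refine hdeg.trans_lt ?_
      simp only [Fintype.card_option, Fintype.card_prod, Fintype.card_fin, Fintype.card_units_int]
      omega
  have := heval v
  rw [hzero, eval_zero] at this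
  exact sub_eq_zero.mp this.symm

end RationalIdentities

/-! ### The operator as a weighted sum of algebra homomorphisms -/

section Operator

variable {n : ℕ}

lemma expo_add (μ ν : Weight n) : expo (μ + ν) = expo μ * expo ν := by
  simp [expo, ← map_mul, AddMonoidAlgebra.single_mul_single]

lemma expo_zero : expo (0 : Weight n) = 1 := by
  simp [expo, ← AddMonoidAlgebra.one_def]

lemma expo_injective : Function.Injective (expo : Weight n → RatFun n) := fun _ _ h =>
  (AddMonoidAlgebra.single_left_inj one_ne_zero).mp
    (IsFractionRing.injective (LaurentAlg n) (RatFun n) h)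

lemma expo_ne_zero (μ : Weight n) : expo μ ≠ 0 := by
  intro h
  have := expo_add μ (-μ)
  rw [h, add_neg_cancel, expo_zero, zero_mul] at this
  exact one_ne_zero this

lemma expo_neg (μ : Weight n) : expo (-μ) = (expo μ)⁻¹ := by
  refine eq_inv_of_mul_eq_one_left ?_
  rw [← expo_add, neg_add_cancel, expo_zero]

/-- The coordinate functions `xᵢ` in the field of rational functions. -/
noncomputable def coordFun (n : ℕ) (i : Fin n) : RatFun n := expo (Pi.single i 1)

lemma coordFun_zpow (i : Fin n) (τ : ℤˣ) :
    coordFun n i ^ ((τ : ℤˣ) : ℤ) = expo (Pi.single i ((τ : ℤˣ) : ℤ)) := by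
  rcases Int.units_eq_one_or τ with rfl | rfl
  · simp [coordFun]
  · simp [coordFun, ← expo_neg, Pi.single_neg]

lemma genericPoint_coordFun {t : ℝ} (ht : t ≠ 0) :
    GenericPoint (algebraMap ℝ (RatFun n) t) (coordFun n) where
  t_ne := by simpa using ht
  ne_zero _ := expo_ne_zero _
  inj := by
    rintro ⟨i, σ⟩ ⟨j, τ⟩ h
    simp only [coordFun_zpow] at h
    have h := expo_injective h
    have hij : i = j := by
      by_contra hij
      have := congrFun h i
      rw [Pi.single_eq_same, Pi.single_eq_of_ne hij] at this
      exact σ.ne_zero this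
    subst hij
    have := Pi.single_injective i h
    exact Prod.ext rfl (Units.ext this)
  -- A monomial with coefficient `t` equals 1 only if `t = 1`.
  res := by
    rw [or_iff_not_imp_left]
    intro h1 i j σ τ h
    apply h1
    rw [coordFun_zpow, coordFun_zpow, mul_assoc, ← expo_add, expo,
      IsScalarTower.algebraMap_apply ℝ (LaurentAlg n) (RatFun n), ← map_mul] at h
    have h := IsFractionRing.injective (LaurentAlg n) (RatFun n) (h.trans (map_one _).symm)
    rw [AddMonoidAlgebra.coe_algebraMap, Function.comp, AddMonoidAlgebra.single_mul_single,
      AddMonoidAlgebra.one_def, AddMonoidAlgebra.single_inj] at h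
    have : t = 1 := (by simpa using h : _ ∧ t = 1).2
    simp [this]

/-- The translation `f ↦ f(q^{σ/2} x)` as an algebra homomorphism. -/
noncomputable def shiftHom {q : ℝ} (hq : 0 < q) (σ : Fin n → ℤˣ) : LaurentAlg n →ₐ[ℝ] LaurentAlg n :=
  AddMonoidAlgebra.lift ℝ (LaurentAlg n) (Weight n)
    { toFun := fun μ => AddMonoidAlgebra.single μ.toAdd
        (Real.sqrt q ^ (∑ i, ((σ i : ℤˣ) : ℤ) * μ.toAdd i))
      map_one' := by simp [AddMonoidAlgebra.one_def]
      map_mul' := fun μ ν => by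
        rw [AddMonoidAlgebra.single_mul_single, ← zpow_add₀ (Real.sqrt_pos.mpr hq).ne',
          ← Finset.sum_add_distrib]
        simp [mul_add] }

lemma shiftHom_single {q : ℝ} (hq : 0 < q) (σ : Fin n → ℤˣ) (μ : Weight n) (c : ℝ) :
    shiftHom hq σ (AddMonoidAlgebra.single μ c) =
      AddMonoidAlgebra.single μ (Real.sqrt q ^ (∑ i, ((σ i : ℤˣ) : ℤ) * μ i) * c) := by
  rw [shiftHom, AddMonoidAlgebra.lift_single]
  simp [mul_comm]

lemma shift_eq_shiftHom {q : ℝ} (hq : 0 < q) (σ : Fin n → ℤˣ) (f : LaurentAlg n) :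
    shift q σ f = shiftHom hq σ f := by
  rw [shiftHom, AddMonoidAlgebra.lift_apply, shift, Finsupp.sum]
  refine Finset.sum_congr rfl fun μ _ => ?_
  simp [mul_comm]

lemma macdonaldE_eq {q : ℝ} (hq : 0 < q) (t : ℝ) (f : LaurentAlg n) :
    macdonaldE q t f = ∑ σ : Fin n → ℤˣ,
      rootWeight (algebraMap ℝ (RatFun n) t) (signedPoint (coordFun n) σ) *
        algebraMap (LaurentAlg n) (RatFun n) (shiftHom hq σ f) := by
  refine Finset.sum_congr rfl fun σ _ => ?_
  rw [shift_eq_shiftHom hq, rootWeight]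
  congr 2
  · refine Finset.prod_congr rfl fun i _ => ?_
    rw [signedPoint, coordFun_zpow, pow_two, ← expo_add, Algebra.smul_def, ← Pi.single_add, two_mul]
  · refine Finset.prod_congr rfl fun i _ => Finset.prod_congr rfl fun j _ => ?_
    rw [signedPoint, signedPoint, coordFun_zpow, coordFun_zpow, ← expo_add, Algebra.smul_def]

lemma macdonaldE_add {q : ℝ} (hq : 0 < q) (t : ℝ) (f g : LaurentAlg n) :
    macdonaldE q t (f + g) = macdonaldE q t f + macdonaldE q t g := by
  simp only [macdonaldE_eq hq, map_add, mul_add, Finset.sum_add_distrib]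

lemma macdonaldE_smul {q : ℝ} (hq : 0 < q) (t c : ℝ) (f : LaurentAlg n) :
    macdonaldE q t (c • f) = c • macdonaldE q t f := by
  rw [macdonaldE_eq hq, macdonaldE_eq hq, Finset.smul_sum]
  refine Finset.sum_congr rfl fun σ _ => ?_
  rw [map_smul, Algebra.smul_def, map_mul, ← IsScalarTower.algebraMap_apply, Algebra.smul_def]
  ring

end Operator

/-! ### The generating series of the one-row polynomials and its functional equations -/

section GeneratingSeries

open PowerSeries

/-- The coefficient `(t; q)_r / (q; q)_r`. -/
noncomputable def binomCoeff (q t : ℝ) (r : ℕ) : ℝ := qPoch t q r / qPoch q q r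

/-- The series `∑ (t; q)_r / (q; q)_r X^r`. -/
noncomputable def binomSeries (q t : ℝ) : ℝ⟦X⟧ := PowerSeries.mk (binomCoeff q t)

lemma qPoch_self_ne_zero {q : ℝ} (hq0 : 0 < q) (hq1 : q < 1) (r : ℕ) : qPoch q q r ≠ 0 := by
  refine Finset.prod_ne_zero_iff.mpr fun j _ => ?_
  rw [← pow_succ']
  exact (sub_pos.mpr (pow_lt_one₀ hq0.le hq1 (Nat.succ_ne_zero j))).ne'

lemma binomCoeff_succ {q : ℝ} (hq0 : 0 < q) (hq1 : q < 1) (t : ℝ) (r : ℕ) :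
    binomCoeff q t (r + 1) * (1 - q ^ (r + 1)) = binomCoeff q t r * (1 - t * q ^ r) := by
  have h1 : 1 - q * q ^ r ≠ 0 := by
    rw [← pow_succ']
    exact (sub_pos.mpr (pow_lt_one₀ hq0.le hq1 (Nat.succ_ne_zero r))).ne'
  simp only [binomCoeff]
  rw [show qPoch t q (r + 1) = qPoch t q r * (1 - t * q ^ r) from Finset.prod_range_succ _ _,
    show qPoch q q (r + 1) = qPoch q q r * (1 - q * q ^ r) from Finset.prod_range_succ _ _,
    pow_succ' q r]
  rw [div_mul_eq_mul_div, div_mul_eq_mul_div, mul_div_mul_right _ _ h1]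

lemma binomCoeff_zero (q t : ℝ) : binomCoeff q t 0 = 1 := by simp [binomCoeff, qPoch]

/-- The formal version of the product (tX;q)_∞/(X;q)_∞, obtained from the two-term recursion of the
coefficients, so that no infinite product is needed. -/
lemma binomSeries_functional {q : ℝ} (hq0 : 0 < q) (hq1 : q < 1) (t : ℝ) :
    (1 - X) * binomSeries q t = (1 - C t * X) * rescale q (binomSeries q t) := by
  ext r
  rcases r with _ | r
  · simp only [sub_mul, mul_assoc, one_mul, map_sub, coeff_zero_X_mul, coeff_C_mul, coeff_rescale,
      pow_zero]
    ring
  · have := binomCoeff_succ hq0 hq1 t r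
    simp only [sub_mul, mul_assoc, one_mul, map_sub, coeff_succ_X_mul, coeff_C_mul, coeff_rescale,
      binomSeries, coeff_mk]
    rw [pow_succ] at *
    linear_combination this

variable {R : Type*} [CommRing R] [Algebra ℝ R]

/-- The series `∑ (t; q)_r / (q; q)_r (z X)^r` with coefficients in an `ℝ`-algebra. -/
noncomputable def binomSeriesAt (q t : ℝ) (z : R) : R⟦X⟧ :=
  rescale z (PowerSeries.map (algebraMap ℝ R) (binomSeries q t))

lemma binomSeriesAt_functional {q : ℝ} (hq0 : 0 < q) (hq1 : q < 1) (t : ℝ) (z : R) :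
    (1 - C z * X) * binomSeriesAt q t z =
      (1 - C (algebraMap ℝ R t * z) * X) * binomSeriesAt q t (algebraMap ℝ R q * z) := by
  have h := congrArg (fun F => rescale z (PowerSeries.map (algebraMap ℝ R) F))
    (binomSeries_functional hq0 hq1 t)
  simp only [map_mul, map_sub, map_one, map_X, map_C, rescale_X, ← rescale_map,
    rescale_rescale] at h
  have hC : ∀ c : R, rescale z (C c) = C c := fun c => by
    ext k
    rw [coeff_rescale, coeff_C]
    split_ifs with hk <;> simp [hk]
  rw [hC] at h
  simp only [binomSeriesAt, map_mul]
  rw [h]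
  ring

lemma map_binomSeriesAt {S : Type*} [CommRing S] [Algebra ℝ S] (f : R →ₐ[ℝ] S) (q t : ℝ) (z : R) :
    PowerSeries.map (f : R →+* S) (binomSeriesAt q t z) = binomSeriesAt q t (f z) := by
  ext r
  simp [binomSeriesAt, coeff_rescale]

lemma rescale_binomSeriesAt (q t : ℝ) (c z : R) :
    rescale c (binomSeriesAt q t z) = binomSeriesAt q t (c * z) := by
  rw [binomSeriesAt, rescale_rescale, mul_comm, binomSeriesAt]

lemma coeff_binomSeriesAt (q t : ℝ) (z : R) (r : ℕ) :
    coeff r (binomSeriesAt q t z) = z ^ r * algebraMap ℝ R (binomCoeff q t r) := by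
  simp [binomSeriesAt, coeff_rescale, binomSeries]

/-- The product of the series attached to the entries of two families. -/
noncomputable def pairSeries (q t : ℝ) {n : ℕ} (a b : Fin n → R) : R⟦X⟧ :=
  ∏ i, (binomSeriesAt q t (a i) * binomSeriesAt q t (b i))

/-- The generating series `∏ᵢ φ(xᵢ X) φ(xᵢ⁻¹ X)` of the one-row polynomials. -/
noncomputable def oneRowSeries (n : ℕ) (q t : ℝ) : (LaurentAlg n)⟦X⟧ :=
  pairSeries q t (fun i => AddMonoidAlgebra.single (Pi.single i 1) 1)
    (fun i => AddMonoidAlgebra.single (Pi.single i (-1)) 1)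

/-- The coefficients of `oneRowSeries`. -/
noncomputable def oneRowPoly (n : ℕ) (q t : ℝ) (r : ℕ) : LaurentAlg n :=
  coeff r (oneRowSeries n q t)

lemma map_pairSeries {S : Type*} [CommRing S] [Algebra ℝ S] (f : R →ₐ[ℝ] S) (q t : ℝ) {n : ℕ}
    (a b : Fin n → R) : PowerSeries.map (f : R →+* S) (pairSeries q t a b) =
      pairSeries q t (fun i => f (a i)) (fun i => f (b i)) := by
  simp [pairSeries, map_binomSeriesAt]

lemma rescale_pairSeries (q t : ℝ) {n : ℕ} (c : R) (a b : Fin n → R) :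
    rescale c (pairSeries q t a b) = pairSeries q t (fun i => c * a i) (fun i => c * b i) := by
  simp [pairSeries, rescale_binomSeriesAt]

lemma map_linProd {R S : Type*} [CommRing R] [CommRing S] (f : R →+* S) {n : ℕ} (a b : Fin n → R)
    (v : R) : f (linProd a b v) = linProd (fun i => f (a i)) (fun i => f (b i)) (f v) := by
  simp [linProd]

/-- Expresses G(qX) through G(X) without denominators. -/
lemma linProd_mul_pairSeries {q : ℝ} (hq0 : 0 < q) (hq1 : q < 1) (t : ℝ) {n : ℕ}
    (a b : Fin n → R) :
    linProd (fun i => C (algebraMap ℝ R t * a i)) (fun i => C (algebraMap ℝ R t * b i)) X *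
        pairSeries q t (fun i => algebraMap ℝ R q * a i) (fun i => algebraMap ℝ R q * b i) =
      linProd (fun i => C (a i)) (fun i => C (b i)) X * pairSeries q t a b := by
  simp only [linProd, pairSeries, ← Finset.prod_mul_distrib]
  refine Finset.prod_congr rfl fun i _ => ?_
  linear_combination (-1 : R⟦X⟧) * ((1 - C (algebraMap ℝ R t * b i) * X) *
      binomSeriesAt q t (algebraMap ℝ R q * b i)) * binomSeriesAt_functional hq0 hq1 t (a i) -
    ((1 - C (a i) * X) * binomSeriesAt q t (a i)) * binomSeriesAt_functional hq0 hq1 t (b i)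

/-- Only the family `a` is multiplied by `q`: this is the effect on G of a translation by signs
followed by X ↦ q^{1/2} X. -/
lemma linProd_mul_pairSeries_left {q : ℝ} (hq0 : 0 < q) (hq1 : q < 1) (t : ℝ) {n : ℕ}
    (a b : Fin n → R) :
    linProd (fun i => C (algebraMap ℝ R t * a i)) (fun i => C (algebraMap ℝ R t * b i)) X *
        pairSeries q t (fun i => algebraMap ℝ R q * a i) b =
      linProd (fun i => C (a i)) (fun i => C (algebraMap ℝ R t * b i)) X *
        pairSeries q t a b := by
  simp only [linProd, pairSeries, ← Finset.prod_mul_distrib]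
  refine Finset.prod_congr rfl fun i _ => ?_
  linear_combination (-1 : R⟦X⟧) * ((1 - C (algebraMap ℝ R t * b i) * X) *
      binomSeriesAt q t (b i)) * binomSeriesAt_functional hq0 hq1 t (a i)

end GeneratingSeries

/-! ### From the rational identity to generating series in two variables -/

section TwoVariables

open PowerSeries

lemma GenericPoint.map {K L : Type*} [Field K] [Field L] (f : K →+* L) {t : K} {n : ℕ}
    {x : Fin n → K} (h : GenericPoint t x) : GenericPoint (f t) (f ∘ x) where
  t_ne := by simpa using h.t_ne
  ne_zero i := by simpa using h.ne_zero i
  inj p p' hp := by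
    simp only [Function.comp, ← map_zpow₀] at hp
    exact h.inj (f.injective hp)
  res := h.res.imp (fun h => by simp [h]) fun h i j σ τ h' => h i j σ τ (f.injective (by
    simpa using h'))

lemma signedPoint_map {K L : Type*} [Field K] [Field L] (f : K →+* L) {n : ℕ} (x : Fin n → K)
    (σ : Fin n → ℤˣ) : signedPoint (f ∘ x) σ = f ∘ signedPoint x σ := by
  ext i
  simp [signedPoint]

lemma rootWeight_map {K L : Type*} [Field K] [Field L] (f : K →+* L) {n : ℕ} (t : K)
    (y : Fin n → K) : rootWeight (f t) (f ∘ y) = f (rootWeight t y) := by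
  simp [rootWeight]

lemma map_pairSum {R S : Type*} [CommRing R] [CommRing S] (f : R →+* S) (t : R) (m : ℕ)
    (v w a b c d : R) :
    f (pairSum t m v w a b c d) = pairSum (f t) m (f v) (f w) (f a) (f b) (f c) (f d) := by
  simp [pairSum, onePlusPowers]

/-- `pairSum` is linear in the pair `(Dv, Bv)` and in the pair `(Dw, Bw)`, and the hypotheses say
that these are proportional to `(Gv, Qv)` and `(Gw, Qw)`. -/
lemma pairSum_mul {R : Type*} [CommRing R] {t v w Dv Dw Bv Bw Gv Gw Qv Qw : R} {m : ℕ}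
    (hv : Bv * Gv = Dv * Qv) (hw : Bw * Gw = Dw * Qw) :
    Gv * Gw * pairSum t m v w Dv Dw Bv Bw = Dv * Dw * pairSum t m v w Gv Gw Qv Qw := by
  have h1 : Gv * Gw * (Bv * Dw) = Dv * Dw * (Qv * Gw) := by linear_combination Gw * Dw * hv
  have h2 : Gv * Gw * (Dv * Bw) = Dv * Dw * (Gv * Qw) := by linear_combination Gv * Dv * hw
  have h3 : Gv * Gw * (Bv * Bw) = Dv * Dw * (Qv * Qw) := by
    linear_combination Gw * Bw * hv + Dv * Qv * hw
  simp only [pairSum]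
  generalize onePlusPowers t m = P
  linear_combination P * (t ^ (m + 1) * (1 - t * v * w) * ((t * v - w) * h1 - (t * w - v) * h2) +
    t ^ (2 * m + 3) * (v - w) * (1 - t ^ 2 * v * w) * h3)

lemma map_mul_eq_map_mul {R S : Type*} [CommRing R] [CommRing S] (f : R →+* S) {a b c d : R}
    (h : a * b = c * d) : f a * f b = f c * f d := by
  rw [← map_mul, h, map_mul]

/-- Replaces the polynomial factors N_σ by the translated series G N_σ/D, with the common
denominators cleared and cancelled at the end. -/
lemma pairSum_transfer {R ι : Type*} [CommRing R] [IsDomain R] [Fintype ι]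
    {A t v w D D' B B' G G' Q Q' : R} {W N N' P P' : ι → R} {m : ℕ} (hD : D ≠ 0) (hD' : D' ≠ 0)
    (hN : ∀ σ, N σ * G = D * P σ) (hN' : ∀ σ, N' σ * G' = D' * P' σ)
    (hB : B * G = D * Q) (hB' : B' * G' = D' * Q')
    (h : A * ∑ σ, W σ * N σ * N' σ = pairSum t m v w D D' B B') :
    A * ∑ σ, W σ * P σ * P' σ = pairSum t m v w G G' Q Q' := by
  refine mul_left_cancel₀ (mul_ne_zero hD hD') ?_
  have e : (∑ σ, W σ * N σ * N' σ) * (G * G') = (∑ σ, W σ * P σ * P' σ) * (D * D') := by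
    rw [Finset.sum_mul, Finset.sum_mul]
    refine Finset.sum_congr rfl fun σ _ => ?_
    linear_combination (W σ * D' * P' σ) * hN σ + W σ * N σ * G * hN' σ
  rw [← pairSum_mul hB hB', ← h]
  linear_combination -A * e

variable {K : Type*} [Field K]

/-- The inner variable `C X` plays v and the outer variable `X` plays w. In the fraction field of
the iterated series ring, w is an indeterminate, so it avoids all excluded values. -/
lemma GenericPoint.sum_rootWeight_powerSeries {t : K} {m : ℕ} {x : Fin (m + 2) → K}
    (h : GenericPoint t x) :
    (C X - X : K⟦X⟧⟦X⟧) * (1 - C (C t) * C X * X) * ∑ σ, C (C (rootWeight t (signedPoint x σ))) *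
        linProd (fun i => C (C (signedPoint x σ i)))
          (fun i => C (C (t * (signedPoint x σ i)⁻¹))) (C X) *
        linProd (fun i => C (C (signedPoint x σ i)))
          (fun i => C (C (t * (signedPoint x σ i)⁻¹))) X =
    pairSum (C (C t)) m (C X) X
      (linProd (fun i => C (C (t * x i))) (fun i => C (C (t * (x i)⁻¹))) (C X))
      (linProd (fun i => C (C (t * x i))) (fun i => C (C (t * (x i)⁻¹))) X)
      (linProd (fun i => C (C (x i))) (fun i => C (C (x i)⁻¹)) (C X))
      (linProd (fun i => C (C (x i))) (fun i => C (C (x i)⁻¹)) X) := by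
  have hinj : Function.Injective (algebraMap K⟦X⟧⟦X⟧ (FractionRing K⟦X⟧⟦X⟧)) :=
    IsFractionRing.injective _ _
  apply hinj
  set f : K →+* FractionRing K⟦X⟧⟦X⟧ :=
    (algebraMap K⟦X⟧⟦X⟧ (FractionRing K⟦X⟧⟦X⟧)).comp ((C).comp C) with hf
  have hf' : ∀ c : K, algebraMap K⟦X⟧⟦X⟧ (FractionRing K⟦X⟧⟦X⟧) (C (C c)) = f c := fun _ => rfl
  have key := (h.map f).sum_rootWeight_mul_linProd_mul_linProd
    (w := algebraMap K⟦X⟧⟦X⟧ (FractionRing K⟦X⟧⟦X⟧) X) ?_ ?_ ?_ ?_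
    (algebraMap K⟦X⟧⟦X⟧ (FractionRing K⟦X⟧⟦X⟧) (C X))
  · simp only [signedPoint_map, rootWeight_map] at key
    simp only [map_mul, map_sum, map_sub, map_one, map_pairSum, map_linProd, hf', map_inv₀]
    simpa only [Function.comp_def] using key
  · rw [← map_zero (algebraMap K⟦X⟧⟦X⟧ (FractionRing K⟦X⟧⟦X⟧))]
    exact fun h => X_ne_zero (hinj h)
  · rw [← hf', ← map_mul, ← map_mul, ← map_one (algebraMap K⟦X⟧⟦X⟧ (FractionRing K⟦X⟧⟦X⟧))]
    intro h
    have := congrArg constantCoeff (hinj h)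
    simp at this
  · intro k τ
    rw [Function.comp, ← map_zpow₀, ← hf']
    intro hk
    have := congrArg (fun F => constantCoeff (constantCoeff F)) (hinj hk)
    simp only [constantCoeff_X, map_zero, constantCoeff_C] at this
    exact zpow_ne_zero _ (h.ne_zero k) this.symm
  · intro k τ
    rw [Function.comp, ← map_zpow₀, ← hf', ← hf', ← map_mul, ← map_mul,
      ← map_one (algebraMap K⟦X⟧⟦X⟧ (FractionRing K⟦X⟧⟦X⟧))]
    intro h
    have := congrArg constantCoeff (hinj h)
    simp at this

variable [Algebra ℝ K]

lemma GenericPoint.sum_rootWeight_pairSeries {q t : ℝ} (hq0 : 0 < q) (hq1 : q < 1) {m : ℕ}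
    {x : Fin (m + 2) → K} (h : GenericPoint (algebraMap ℝ K t) x) :
    (C X - X : K⟦X⟧⟦X⟧) * (1 - C (C (algebraMap ℝ K t)) * C X * X) *
      ∑ σ, C (C (rootWeight (algebraMap ℝ K t) (signedPoint x σ))) *
        C (pairSeries q t (fun i => algebraMap ℝ K q * signedPoint x σ i)
          (fun i => (signedPoint x σ i)⁻¹)) *
        PowerSeries.map C (pairSeries q t (fun i => algebraMap ℝ K q * signedPoint x σ i)
          (fun i => (signedPoint x σ i)⁻¹)) =
    pairSum (C (C (algebraMap ℝ K t))) m (C X) X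
      (C (pairSeries q t x (fun i => (x i)⁻¹)))
      (PowerSeries.map C (pairSeries q t x (fun i => (x i)⁻¹)))
      (C (rescale (algebraMap ℝ K q) (pairSeries q t x (fun i => (x i)⁻¹))))
      (PowerSeries.map C (rescale (algebraMap ℝ K q) (pairSeries q t x (fun i => (x i)⁻¹)))) := by
  set tK := algebraMap ℝ K t
  set G := pairSeries q t x (fun i => (x i)⁻¹) with hG
  set Dv : K⟦X⟧ := linProd (fun i => C (tK * x i)) (fun i => C (tK * (x i)⁻¹)) X with hDv
  have key := h.sum_rootWeight_powerSeries
  have hC : ∀ {n : ℕ} (a b : Fin n → K),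
      (linProd (fun i => C (C (a i))) (fun i => C (C (b i))) (C X) : K⟦X⟧⟦X⟧) =
        C (linProd (fun i => C (a i)) (fun i => C (b i)) X) := by
    intro n a b; rw [map_linProd]
  have hM : ∀ {n : ℕ} (a b : Fin n → K),
      (linProd (fun i => C (C (a i))) (fun i => C (C (b i))) X : K⟦X⟧⟦X⟧) =
        PowerSeries.map C (linProd (fun i => C (a i)) (fun i => C (b i)) X) := by
    intro n a b; simp only [map_linProd, map_C, map_X]
  simp only [hC, hM] at key
  have hB : linProd (fun i => C (x i)) (fun i => C (x i)⁻¹) X * G =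
      Dv * rescale (algebraMap ℝ K q) G := by
    rw [hG, rescale_pairSeries, ← linProd_mul_pairSeries hq0 hq1]
  have hN : ∀ σ, linProd (fun i => C (signedPoint x σ i))
        (fun i => C (tK * (signedPoint x σ i)⁻¹)) X * G =
      Dv * pairSeries q t (fun i => algebraMap ℝ K q * signedPoint x σ i)
          (fun i => (signedPoint x σ i)⁻¹) := by
    intro σ
    have h1 := linProd_mul_pairSeries_left hq0 hq1 t (signedPoint x σ)
      (fun i => (signedPoint x σ i)⁻¹)
    have h2 : Dv = linProd (fun i => C (tK * signedPoint x σ i))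
        (fun i => C (tK * (signedPoint x σ i)⁻¹)) X := by
      refine Finset.prod_congr rfl fun i _ => ?_
      rcases Int.units_eq_one_or (σ i) with hi | hi <;> simp only [signedPoint, hi, Units.val_one,
        Units.val_neg, zpow_one, zpow_neg, inv_inv]
      ring
    have h3 : G = pairSeries q t (signedPoint x σ) (fun i => (signedPoint x σ i)⁻¹) := by
      refine Finset.prod_congr rfl fun i _ => ?_
      rcases Int.units_eq_one_or (σ i) with hi | hi <;> simp only [signedPoint, hi, Units.val_one,
        Units.val_neg, zpow_one, zpow_neg, inv_inv]
      ring
    rw [h2, h3, h1]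
  have hD0 : Dv ≠ 0 := by
    intro h0
    have := congrArg constantCoeff h0
    simp [hDv, linProd] at this
  have hD1 : (C Dv : K⟦X⟧⟦X⟧) ≠ 0 := (map_ne_zero_iff _ C_injective).mpr hD0
  have hD2 : (PowerSeries.map C Dv : K⟦X⟧⟦X⟧) ≠ 0 :=
    (map_ne_zero_iff _ (map_injective _ C_injective)).mpr hD0
  exact pairSum_transfer hD1 hD2
    (fun σ => map_mul_eq_map_mul (C : K⟦X⟧ →+* K⟦X⟧⟦X⟧) (hN σ))
    (fun σ => map_mul_eq_map_mul (PowerSeries.map (C : K →+* K⟦X⟧)) (hN σ))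
    (map_mul_eq_map_mul (C : K⟦X⟧ →+* K⟦X⟧⟦X⟧) hB)
    (map_mul_eq_map_mul (PowerSeries.map (C : K →+* K⟦X⟧)) hB) key

end TwoVariables

/-! ### Division by (v - w)(1 - tvw) and comparison of coefficients -/

section CoefficientExtraction

open PowerSeries

variable {K : Type*} [Field K]

/-- The two-variable series with coefficients `h a b`. -/
noncomputable def mkPair (h : ℕ → ℕ → K) : K⟦X⟧⟦X⟧ :=
  PowerSeries.mk fun b => PowerSeries.mk fun a => h a b

lemma coeff_coeff_mkPair (h : ℕ → ℕ → K) (a b : ℕ) : coeff a (coeff b (mkPair h)) = h a b := by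
  simp [mkPair]

lemma coeff_coeff_C_mul_map (F H : K⟦X⟧) (a b : ℕ) :
    coeff a (coeff b (C F * PowerSeries.map C H : K⟦X⟧⟦X⟧)) = coeff a F * coeff b H := by
  rw [coeff_C_mul, coeff_map, coeff_mul_C]

lemma C_mul_map_eq_mkPair (F H : K⟦X⟧) :
    (C F * PowerSeries.map C H : K⟦X⟧⟦X⟧) = mkPair fun a b => coeff a F * coeff b H := by
  ext b a
  rw [coeff_coeff_C_mul_map, coeff_coeff_mkPair]

/-- The coefficients come from the expansion (1 - c vw)/(1 - T vw) = 1 + ∑ (T^{k+1} - T^k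
c)(vw)^{k+1}. -/
lemma one_sub_mul_mkPair (T c : K) (u : ℕ → ℕ → K) :
    (1 - C (C T) * C X * X : K⟦X⟧⟦X⟧) * mkPair (fun a b => u a b +
        ∑ k ∈ Finset.range (min a b), (T ^ (k + 1) - T ^ k * c) * u (a - 1 - k) (b - 1 - k)) =
      (1 - C (C c) * C X * X) * mkPair u := by
  obtain ⟨h, hh⟩ : ∃ h : ℕ → ℕ → K, ∀ a b, h a b = u a b + ∑ k ∈ Finset.range (min a b),
      (T ^ (k + 1) - T ^ k * c) * u (a - 1 - k) (b - 1 - k) := ⟨_, fun _ _ => rfl⟩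
  simp only [← hh]
  ext b a
  rcases b with _ | b
  · simp only [sub_mul, mul_assoc, one_mul, map_sub, coeff_C_mul, coeff_zero_X_mul, mul_zero,
      map_zero, coeff_coeff_mkPair]
    simp [hh]
  rcases a with _ | a
  · simp only [sub_mul, mul_assoc, one_mul, map_sub, coeff_C_mul, coeff_zero_X_mul, mul_zero,
      coeff_coeff_mkPair, coeff_succ_X_mul]
    simp [hh]
  simp only [sub_mul, mul_assoc, one_mul, map_sub, coeff_C_mul, coeff_succ_X_mul,
    coeff_coeff_mkPair]
  have : ∑ k ∈ Finset.range (min a b), (T ^ (k + 1 + 1) - T ^ (k + 1) * c) *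
      u (a + 1 - 1 - (k + 1)) (b + 1 - 1 - (k + 1)) =
      T * ∑ k ∈ Finset.range (min a b), (T ^ (k + 1) - T ^ k * c) * u (a - 1 - k) (b - 1 - k) := by
    rw [Finset.mul_sum]
    refine Finset.sum_congr rfl fun k _ => ?_
    rw [show a + 1 - 1 - (k + 1) = a - 1 - k by omega,
      show b + 1 - 1 - (k + 1) = b - 1 - k by omega]
    ring
  rw [hh, hh, Nat.succ_min_succ, Finset.sum_range_succ', this]
  simp only [Nat.add_sub_cancel, Nat.sub_zero]
  ring

/-- The reflection k ↦ c - 1 - k changes the sign of the sum. -/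
lemma sum_range_antisymm [CharZero K] (Q : K) (γ : ℕ → K) (c : ℕ) :
    ∑ k ∈ Finset.range c, (Q ^ (c - k) - Q ^ (k + 1)) * (γ (k + 1) * γ (c - k)) = 0 := by
  have h : ∑ k ∈ Finset.range c, (Q ^ (c - k) - Q ^ (k + 1)) * (γ (k + 1) * γ (c - k)) =
      -∑ k ∈ Finset.range c, (Q ^ (c - k) - Q ^ (k + 1)) * (γ (k + 1) * γ (c - k)) := by
    conv_lhs => rw [← Finset.sum_range_reflect]
    rw [← Finset.sum_neg_distrib]
    refine Finset.sum_congr rfl fun k hk => ?_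
    have hk := Finset.mem_range.mp hk
    rw [show c - (c - 1 - k) = k + 1 by omega, show c - 1 - k + 1 = c - k by omega]
    ring
  exact self_eq_neg.mp h

/-- The right side is antisymmetric in the two variables, hence divisible by v - w; the series on
the left is the quotient. -/
lemma sub_mul_mkPair [CharZero K] (T Q : K) (F : K⟦X⟧) :
    (C X - X : K⟦X⟧⟦X⟧) * mkPair (fun a b => (T * Q ^ a + Q ^ b) * (coeff a F * coeff b F) +
        (1 - T) * ∑ k ∈ Finset.range b, (Q ^ (b - 1 - k) - Q ^ (a + 1 + k)) *
          (coeff (a + 1 + k) F * coeff (b - 1 - k) F)) =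
      (C (C T) * C X - X) * (C (rescale Q F) * PowerSeries.map C F) -
        (C (C T) * X - C X) * (C F * PowerSeries.map C (rescale Q F)) := by
  obtain ⟨h, hh⟩ : ∃ h : ℕ → ℕ → K, ∀ a b, h a b = (T * Q ^ a + Q ^ b) *
      (coeff a F * coeff b F) + (1 - T) * ∑ k ∈ Finset.range b,
        (Q ^ (b - 1 - k) - Q ^ (a + 1 + k)) * (coeff (a + 1 + k) F * coeff (b - 1 - k) F) :=
    ⟨_, fun _ _ => rfl⟩
  simp only [← hh, C_mul_map_eq_mkPair, coeff_rescale]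
  ext b a
  rcases b with _ | b <;> rcases a with _ | a
  · simp only [sub_mul, mul_assoc, map_sub, coeff_C_mul, coeff_zero_X_mul, mul_zero, map_zero]
    ring
  · simp only [sub_mul, mul_assoc, map_sub, coeff_C_mul, coeff_zero_X_mul, mul_zero, map_zero,
      coeff_succ_X_mul, coeff_coeff_mkPair, hh, Finset.sum_range_zero]
    ring
  · simp only [sub_mul, mul_assoc, map_sub, coeff_C_mul, coeff_zero_X_mul, mul_zero,
      coeff_succ_X_mul, coeff_coeff_mkPair]
    rw [hh]
    rcases b with _ | c
    · rw [Finset.sum_range_zero]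
      ring
    -- Row `a = 0`: all terms of the sum but the last cancel in pairs.
    · have h := sum_range_antisymm Q (fun k => coeff k F) c
      rw [Finset.sum_range_succ]
      simp only [Nat.add_sub_cancel, zero_add, add_comm 1, h, Nat.sub_self, pow_zero]
      ring
  · simp only [sub_mul, mul_assoc, map_sub, coeff_C_mul, coeff_succ_X_mul, coeff_coeff_mkPair]
    have : ∑ k ∈ Finset.range b, (Q ^ (b + 1 - 1 - (k + 1)) - Q ^ (a + 1 + (k + 1))) *
          (coeff (a + 1 + (k + 1)) F * coeff (b + 1 - 1 - (k + 1)) F) =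
        ∑ k ∈ Finset.range b, (Q ^ (b - 1 - k) - Q ^ (a + 1 + 1 + k)) *
          (coeff (a + 1 + 1 + k) F * coeff (b - 1 - k) F) := by
      refine Finset.sum_congr rfl fun k _ => ?_
      rw [show b + 1 - 1 - (k + 1) = b - 1 - k by omega,
        show a + 1 + (k + 1) = a + 1 + 1 + k by ring]
    rw [hh, hh, Finset.sum_range_succ', this]
    simp only [Nat.add_sub_cancel, Nat.sub_zero, add_zero]
    ring

/-- The three summands of `pairSum` are divided separately. Their diagonal terms 1 + T^{m+1}(T Q^a +
Q^b) + T^{2m+3} Q^a Q^b factor into the variable part of the eigenvalue. -/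
lemma coeff_coeff_of_pairSum [CharZero K] {T Q : K} {m : ℕ} {F : K⟦X⟧} {H : K⟦X⟧⟦X⟧}
    (h : (C X - X : K⟦X⟧⟦X⟧) * (1 - C (C T) * C X * X) * H =
      pairSum (C (C T)) m (C X) X (C F) (PowerSeries.map C F) (C (rescale Q F))
        (PowerSeries.map C (rescale Q F))) {a b : ℕ} (hab : b ≤ a) :
    coeff a (coeff b H) = onePlusPowers T m *
      ((1 + T ^ (m + 2) * Q ^ a) * (1 + T ^ (m + 1) * Q ^ b) * (coeff a F * coeff b F) +
        (1 - T) * (T ^ (m + 1) * ∑ k ∈ Finset.range b, (Q ^ (b - 1 - k) - Q ^ (a + 1 + k)) *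
          (coeff (a + 1 + k) F * coeff (b - 1 - k) F) -
        ∑ k ∈ Finset.range b, T ^ k * (1 - T ^ (2 * m + 4) * Q ^ (a - 1 - k) * Q ^ (b - 1 - k)) *
          (coeff (a - 1 - k) F * coeff (b - 1 - k) F))) := by
  set H1 := mkPair (fun a b => (T * Q ^ a + Q ^ b) * (coeff a F * coeff b F) +
        (1 - T) * ∑ k ∈ Finset.range b, (Q ^ (b - 1 - k) - Q ^ (a + 1 + k)) *
          (coeff (a + 1 + k) F * coeff (b - 1 - k) F)) with hH1
  set H2 := mkPair (fun a b => (coeff a F * coeff b F) +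
        ∑ k ∈ Finset.range (min a b), (T ^ (k + 1) - T ^ k * 1) *
          (coeff (a - 1 - k) F * coeff (b - 1 - k) F)) with hH2
  set H3 := mkPair (fun a b => ((Q ^ a * coeff a F) * (Q ^ b * coeff b F)) +
        ∑ k ∈ Finset.range (min a b), (T ^ (k + 1) - T ^ k * T ^ 2) *
          ((Q ^ (a - 1 - k) * coeff (a - 1 - k) F) * (Q ^ (b - 1 - k) * coeff (b - 1 - k) F)))
    with hH3
  have e1 : (C X - X : K⟦X⟧⟦X⟧) * H1 = _ := sub_mul_mkPair T Q F
  have e2 : _ * H2 = _ := one_sub_mul_mkPair T 1 fun a b => coeff a F * coeff b F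
  have e3 : _ * H3 = _ := one_sub_mul_mkPair T (T ^ 2)
    fun a b => (Q ^ a * coeff a F) * (Q ^ b * coeff b F)
  rw [← C_mul_map_eq_mkPair] at e2
  simp only [← coeff_rescale] at e3
  rw [← C_mul_map_eq_mkPair] at e3
  have hP : onePlusPowers (C (C T) : K⟦X⟧⟦X⟧) m = C (C (onePlusPowers T m)) := by
    simp [onePlusPowers]
  have n1 : (C X - X : K⟦X⟧⟦X⟧) ≠ 0 := by
    intro h0
    have := congrArg (fun F => coeff 1 (coeff 0 F)) h0
    simp [coeff_X] at this
  have n2 : (1 - C (C T) * C X * X : K⟦X⟧⟦X⟧) ≠ 0 := by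
    intro h0
    have := congrArg (fun F => coeff 0 (coeff 0 F)) h0
    simp at this
  have hH : H = C (C (onePlusPowers T m)) *
      (H2 + C (C T) ^ (m + 1) * H1 + C (C T) ^ (2 * m + 3) * H3) := by
    refine mul_left_cancel₀ (mul_ne_zero n1 n2) ?_
    rw [h, pairSum, hP]
    rw [map_pow, map_pow] at e3
    rw [map_one, map_one] at e2
    generalize (C (C T) : K⟦X⟧⟦X⟧) = T' at *
    generalize (C X : K⟦X⟧⟦X⟧) = v at *
    generalize (X : K⟦X⟧⟦X⟧) = w at *
    generalize (C F : K⟦X⟧⟦X⟧) = Gv at *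
    generalize (C (rescale Q F) : K⟦X⟧⟦X⟧) = Qv at *
    generalize (PowerSeries.map C F : K⟦X⟧⟦X⟧) = Gw at *
    generalize (PowerSeries.map C (rescale Q F) : K⟦X⟧⟦X⟧) = Qw at *
    generalize (C (C (onePlusPowers T m)) : K⟦X⟧⟦X⟧) = P at *
    clear_value H1 H2 H3
    linear_combination -P * ((v - w) * e2 + T' ^ (m + 1) * (1 - T' * v * w) * e1 +
      T' ^ (2 * m + 3) * (v - w) * e3)
  rw [hH]
  simp only [← map_pow, coeff_C_mul, map_add, hH1, hH2, hH3, coeff_coeff_mkPair,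
    min_eq_right hab]
  congr 1
  -- The geometric tails of the first and third summands merge, with the common factor `-(1 - T)`.
  have s2 : ∑ k ∈ Finset.range b, (T ^ (k + 1) - T ^ k * 1) *
        (coeff (a - 1 - k) F * coeff (b - 1 - k) F) +
      T ^ (2 * m + 3) * ∑ k ∈ Finset.range b, (T ^ (k + 1) - T ^ k * T ^ 2) *
        (Q ^ (a - 1 - k) * coeff (a - 1 - k) F * (Q ^ (b - 1 - k) * coeff (b - 1 - k) F)) =
      -(1 - T) * ∑ k ∈ Finset.range b,
        T ^ k * (1 - T ^ (2 * m + 4) * Q ^ (a - 1 - k) * Q ^ (b - 1 - k)) *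
          (coeff (a - 1 - k) F * coeff (b - 1 - k) F) := by
    rw [Finset.mul_sum, Finset.mul_sum, ← Finset.sum_add_distrib]
    exact Finset.sum_congr rfl fun k _ => by ring
  linear_combination s2

end CoefficientExtraction

/-! ### The operator on a product of two one-row polynomials -/

section ProductFormula

open PowerSeries

lemma algebraMap_smul_ratFun {n : ℕ} (c : ℝ) (f : LaurentAlg n) :
    algebraMap (LaurentAlg n) (RatFun n) (c • f) =
      algebraMap ℝ (RatFun n) c * algebraMap (LaurentAlg n) (RatFun n) f := by
  rw [Algebra.smul_def, map_mul, ← IsScalarTower.algebraMap_apply]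

lemma algebraMap_single_eq_expo {n : ℕ} (μ : Weight n) :
    algebraMap (LaurentAlg n) (RatFun n) (AddMonoidAlgebra.single μ 1) = expo μ := rfl

lemma coeff_pairSeries_coordFun (n : ℕ) (q t : ℝ) (r : ℕ) :
    coeff r (pairSeries q t (coordFun n) fun i => (coordFun n i)⁻¹) =
      algebraMap (LaurentAlg n) (RatFun n) (oneRowPoly n q t r) := by
  have h := map_pairSeries (IsScalarTower.toAlgHom ℝ (LaurentAlg n) (RatFun n)) q t
    (fun i => AddMonoidAlgebra.single (Pi.single i 1) 1)
    (fun i => AddMonoidAlgebra.single (Pi.single i (-1)) 1)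
  have h2 : ∀ i, (coordFun n i)⁻¹ = expo (Pi.single i (-1)) := fun i => by
    rw [coordFun, ← expo_neg, Pi.single_neg]
  have h3 := congrArg (coeff r) h
  rw [coeff_map] at h3
  simp only [h2]
  exact h3.symm

/-- The translation sends y_i^{±1} to q^{±1/2} y_i^{±1}. Rescaling X by q^{1/2} turns this into q
y_i and y_i⁻¹, at the cost of the factor q^{r/2}. -/
lemma coeff_pairSeries_signed {n : ℕ} {q : ℝ} (hq : 0 < q) (t : ℝ) (σ : Fin n → ℤˣ) (r : ℕ) :
    coeff r (pairSeries q t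
        (fun i => algebraMap ℝ (RatFun n) q * signedPoint (coordFun n) σ i)
        (fun i => (signedPoint (coordFun n) σ i)⁻¹)) =
      algebraMap ℝ (RatFun n) (Real.sqrt q) ^ r *
        algebraMap (LaurentAlg n) (RatFun n) (shiftHom hq σ (oneRowPoly n q t r)) := by
  have h := map_pairSeries
    ((IsScalarTower.toAlgHom ℝ (LaurentAlg n) (RatFun n)).comp (shiftHom hq σ)) q t
    (fun i => AddMonoidAlgebra.single (Pi.single i 1) 1)
    (fun i => AddMonoidAlgebra.single (Pi.single i (-1)) 1)
  have h3 := congrArg (fun F => coeff r (rescale (algebraMap ℝ (RatFun n) (Real.sqrt q)) F)) h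
  simp only [coeff_rescale, coeff_map] at h3
  refine Eq.trans ?_ h3.symm
  rw [← coeff_rescale, rescale_pairSeries]
  congr 1
  have hs : Real.sqrt q ≠ 0 := (Real.sqrt_pos.mpr hq).ne'
  have hsK : algebraMap ℝ (RatFun n) (Real.sqrt q) ≠ 0 := by simpa using hs
  have hq2 : algebraMap ℝ (RatFun n) q =
      algebraMap ℝ (RatFun n) (Real.sqrt q) * algebraMap ℝ (RatFun n) (Real.sqrt q) := by
    rw [← map_mul, Real.mul_self_sqrt hq.le]
  have key : ∀ (i : Fin n) (c : ℤ), (IsScalarTower.toAlgHom ℝ (LaurentAlg n) (RatFun n))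
      (shiftHom hq σ (AddMonoidAlgebra.single (Pi.single i c) 1)) =
      algebraMap ℝ (RatFun n) (Real.sqrt q) ^ (((σ i : ℤˣ) : ℤ) * c) * expo (Pi.single i c) := by
    intro i c
    rw [shiftHom_single, Finset.sum_eq_single i (fun j _ hj => by simp [hj]) (by simp)]
    rw [Pi.single_eq_same, ← smul_eq_mul, ← AddMonoidAlgebra.smul_single, map_smul,
      Algebra.smul_def, map_zpow₀]
    rfl
  refine Finset.prod_congr rfl fun i _ => ?_
  simp only [AlgHom.comp_apply, key]
  have e1 : expo (Pi.single i (1 : ℤ)) = coordFun n i := rfl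
  have e2 : expo (Pi.single i (-1 : ℤ)) = (coordFun n i)⁻¹ := by
    rw [coordFun, ← expo_neg, Pi.single_neg]
  rw [e1, e2, signedPoint, hq2]
  rcases Int.units_eq_one_or (σ i) with h | h <;> rw [h]
  · simp [hsK, mul_assoc]
  · rw [mul_comm]
    simp [hsK, mul_assoc]

lemma sum_Icc_one_eq_sum_range {M : Type*} [AddCommMonoid M] (f : ℕ → M) (b : ℕ) :
    ∑ k ∈ Finset.Icc 1 b, f k = ∑ k ∈ Finset.range b, f (k + 1) := by
  induction b with
  | zero => simp
  | succ b ih => rw [Finset.sum_Icc_succ_top (by omega), ih, Finset.sum_range_succ]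

lemma eigen_twoRow {q : ℝ} (hq : 0 < q) (t : ℝ) (m a b : ℕ) :
    eigen q t (twoRow (m + 2) a b) = (Real.sqrt q ^ (a + b))⁻¹ * onePlusPowers t m *
      ((1 + t ^ (m + 2) * q ^ a) * (1 + t ^ (m + 1) * q ^ b)) := by
  have hs : Real.sqrt q ≠ 0 := (Real.sqrt_pos.mpr hq).ne'
  have hq2 : q = Real.sqrt q ^ 2 := (Real.sq_sqrt hq.le).symm
  have h : onePlusPowers t m = ∏ i : Fin m, (t ^ (m - (i : ℕ)) + 1) := by
    rw [onePlusPowers, ← Finset.prod_range_reflect,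
      Finset.prod_range fun i => t ^ (m - 1 - i + 1) + 1]
    refine Finset.prod_congr rfl fun i _ => ?_
    rw [show m - 1 - (i : ℕ) + 1 = m - i by omega]
  rw [eigen, Fin.prod_univ_succ, Fin.prod_univ_succ, h]
  simp only [twoRow, Fin.val_succ, Fin.val_zero, if_true, zero_add, one_ne_zero, if_false,
    Nat.add_eq_zero_iff, and_false, Nat.add_eq_right, zpow_zero, neg_zero, one_mul,
    Nat.sub_zero, zpow_neg, zpow_natCast]
  rw [hq2, Real.sqrt_sq (Real.sqrt_nonneg _)]
  have e : ∀ i : Fin m, m + 2 - ((i : ℕ) + 1 + 1) = m - i := fun i => by omega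
  simp only [e]
  rw [show m + 2 - 1 = m + 1 by omega]
  generalize Real.sqrt q = s at *
  field_simp
  ring

/-- The action of the Macdonald operator on a product of two one-row polynomials, with
coefficients not yet normalized. -/
lemma macdonaldE_oneRowPoly_mul_add_two {q t : ℝ} (hq0 : 0 < q) (hq1 : q < 1) (ht : 0 < t)
    {m a b : ℕ} (hab : b ≤ a) :
    macdonaldE q t (oneRowPoly (m + 2) q t a * oneRowPoly (m + 2) q t b) =
      algebraMap _ _ (((Real.sqrt q ^ (a + b))⁻¹ * onePlusPowers t m) •
        (((1 + t ^ (m + 2) * q ^ a) * (1 + t ^ (m + 1) * q ^ b)) •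
          (oneRowPoly (m + 2) q t a * oneRowPoly (m + 2) q t b) +
        (1 - t) • (t ^ (m + 1) • ∑ k ∈ Finset.range b, (q ^ (b - 1 - k) - q ^ (a + 1 + k)) •
          (oneRowPoly (m + 2) q t (a + 1 + k) * oneRowPoly (m + 2) q t (b - 1 - k)) -
        ∑ k ∈ Finset.range b,
          (t ^ k * (1 - t ^ (2 * m + 4) * q ^ (a - 1 - k) * q ^ (b - 1 - k))) •
          (oneRowPoly (m + 2) q t (a - 1 - k) * oneRowPoly (m + 2) q t (b - 1 - k))))) := by
  have hs : Real.sqrt q ≠ 0 := (Real.sqrt_pos.mpr hq0).ne'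
  have hsK : algebraMap ℝ (RatFun (m + 2)) (Real.sqrt q) ≠ 0 := by simpa using hs
  have : CharZero (RatFun (m + 2)) := charZero_of_injective_algebraMap
    (algebraMap ℝ (RatFun (m + 2))).injective
  have h := coeff_coeff_of_pairSum
    ((genericPoint_coordFun (n := m + 2) ht.ne').sum_rootWeight_pairSeries hq0 hq1) hab
  simp only [coeff_pairSeries_coordFun] at h
  rw [macdonaldE_eq hq0]
  simp only [algebraMap_smul_ratFun, map_add, map_sub, map_mul, map_sum, map_one, map_pow, map_inv₀]
  rw [show algebraMap ℝ (RatFun (m + 2)) (onePlusPowers t m) =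
    onePlusPowers (algebraMap ℝ (RatFun (m + 2)) t) m by simp [onePlusPowers]]
  rw [mul_assoc, ← h, eq_inv_mul_iff_mul_eq₀ (pow_ne_zero _ hsK), Finset.mul_sum, map_sum, map_sum]
  refine Finset.sum_congr rfl fun σ _ => ?_
  rw [mul_assoc, coeff_C_mul, coeff_C_mul, coeff_coeff_C_mul_map, coeff_pairSeries_signed hq0,
    coeff_pairSeries_signed hq0, pow_add]
  ring

/-- No genericity of `t` is needed, because the statement concerns the coefficients of the series
and not Macdonald polynomials. -/
theorem macdonaldE_oneRowPoly_mul {n : ℕ} (hn : 2 ≤ n) {q t : ℝ} (hq0 : 0 < q) (hq1 : q < 1)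
    (ht : 0 < t) {a b : ℕ} (hab : b ≤ a) :
    macdonaldE q t (oneRowPoly n q t a * oneRowPoly n q t b) =
      algebraMap (LaurentAlg n) (RatFun n)
        (eigen q t (twoRow n a b) • (oneRowPoly n q t a * oneRowPoly n q t b) +
          ((1 - t) * ∏ i ∈ Finset.Icc 1 (n - 2), (t ^ i + 1)) •
            ((Real.sqrt q ^ (-((a : ℤ) - b)) * t ^ (n - 1)) •
                ∑ k ∈ Finset.Icc 1 b,
                  ((q ^ k)⁻¹ * (1 - q ^ (2 * (k : ℤ) + a - b))) •
                    (oneRowPoly n q t (a + k) * oneRowPoly n q t (b - k)) -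
              (Real.sqrt q ^ (-((a : ℤ) + b))) •
                ∑ k ∈ Finset.Icc 1 b,
                  (t ^ (k - 1) * (1 - q ^ (-2 * (k : ℤ) + a + b) * t ^ (2 * n))) •
                    (oneRowPoly n q t (a - k) * oneRowPoly n q t (b - k)))) := by
  obtain ⟨m, rfl⟩ : ∃ m, n = m + 2 := ⟨n - 2, by omega⟩
  have hs : Real.sqrt q ≠ 0 := (Real.sqrt_pos.mpr hq0).ne'
  have hP : ∏ i ∈ Finset.Icc 1 (m + 2 - 2), (t ^ i + 1) = onePlusPowers t m := by
    rw [onePlusPowers, Nat.add_sub_cancel]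
    induction m with
    | zero => simp
    | succ m ih => rw [Finset.prod_Icc_succ_top (by omega), ih (by omega), Finset.prod_range_succ]
  have hq2 : q = Real.sqrt q ^ 2 := (Real.sq_sqrt hq0.le).symm
  -- The half-integral power is common to both sums; the remaining `q ^ b` meets `q ^ (-k)` to give
  -- q^{b-k}.
  have c1 : Real.sqrt q ^ (-((a : ℤ) - b)) = (Real.sqrt q ^ (a + b))⁻¹ * q ^ b := by
    conv_rhs => rw [hq2, Real.sqrt_sq (Real.sqrt_nonneg _)]
    rw [neg_sub, zpow_sub₀ hs, zpow_natCast, zpow_natCast]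
    field_simp
    ring
  have c2 : Real.sqrt q ^ (-((a : ℤ) + b)) = (Real.sqrt q ^ (a + b))⁻¹ := by
    rw [zpow_neg, ← Nat.cast_add, zpow_natCast]
  rw [macdonaldE_oneRowPoly_mul_add_two hq0 hq1 ht hab, eigen_twoRow hq0, hP, c1, c2,
    sum_Icc_one_eq_sum_range, sum_Icc_one_eq_sum_range]
  congr 1
  simp only [smul_add, smul_sub, Finset.smul_sum, smul_smul]
  congr 2
  · refine Finset.sum_congr rfl fun k hk => ?_
    have hk := Finset.mem_range.mp hk
    rw [show a + (k + 1) = a + 1 + k by ring, show b - (k + 1) = b - 1 - k by omega]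
    congr 1
    obtain ⟨d, rfl⟩ : ∃ d, b = d + 1 + k := ⟨b - 1 - k, by omega⟩
    have e : q ^ (2 * ((k + 1 : ℕ) : ℤ) + a - (d + 1 + k : ℕ)) =
        q ^ (a + 1 + k) * (q ^ d)⁻¹ := by
      rw [← zpow_natCast q d, ← zpow_natCast, ← zpow_neg, ← zpow_add₀ hq0.ne']
      congr 1
      push_cast
      ring
    rw [e, show d + 1 + k - 1 - k = d by omega, show m + 2 - 1 = m + 1 by omega]
    field_simp
    ring
  · refine Finset.sum_congr rfl fun k hk => ?_
    have hk := Finset.mem_range.mp hk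
    rw [show a - (k + 1) = a - 1 - k by omega, show b - (k + 1) = b - 1 - k by omega]
    congr 1
    have e : q ^ (-2 * ((k + 1 : ℕ) : ℤ) + a + b) = q ^ (a - 1 - k) * q ^ (b - 1 - k) := by
      rw [← zpow_natCast q, ← zpow_natCast q, ← zpow_add₀ hq0.ne']
      congr 1
      push_cast [show k ≤ b - 1 by omega, show 1 ≤ b by omega, show k ≤ a - 1 by omega,
        show 1 ≤ a by omega]
      omega
    rw [e, Nat.add_sub_cancel]
    ring

end ProductFormula

/-! ### Signed permutations, orbit sums and leading weights -/

section WeylGroup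

variable {n : ℕ}

/-- The action of a signed permutation on weights. -/
def weylAct (π : Equiv.Perm (Fin n)) (ε : Fin n → ℤˣ) : Weight n ≃+ Weight n where
  toFun μ := fun i => ((ε i : ℤˣ) : ℤ) * μ (π i)
  invFun μ := fun i => ((ε (π.symm i) : ℤˣ) : ℤ) * μ (π.symm i)
  left_inv μ := by
    funext i
    simp [← mul_assoc, ← Units.val_mul]
  right_inv μ := by
    funext i
    simp [← mul_assoc, ← Units.val_mul]
  map_add' μ ν := by
    funext i
    simp [mul_add]

lemma weylAct_apply (π : Equiv.Perm (Fin n)) (ε : Fin n → ℤˣ) (μ : Weight n) (i : Fin n) :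
    weylAct π ε μ i = ((ε i : ℤˣ) : ℤ) * μ (π i) := rfl

lemma mem_weylOrbit {μ ν : Weight n} : ν ∈ weylOrbit μ ↔ ∃ π ε, weylAct π ε μ = ν := by
  simp only [weylOrbit, Finset.mem_image, Finset.mem_univ, true_and, Prod.exists]
  rfl

lemma weylAct_weylAct (π π' : Equiv.Perm (Fin n)) (ε ε' : Fin n → ℤˣ) (μ : Weight n) :
    weylAct π ε (weylAct π' ε' μ) = weylAct (π' * π) (fun i => ε i * ε' (π i)) μ := by
  funext i
  simp [weylAct_apply, mul_assoc]

lemma weylAct_symm (π : Equiv.Perm (Fin n)) (ε : Fin n → ℤˣ) (μ : Weight n) :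
    (weylAct π ε).symm μ = weylAct π.symm (fun i => ε (π.symm i)) μ := rfl

lemma weylAct_mem_weylOrbit_iff (π : Equiv.Perm (Fin n)) (ε : Fin n → ℤˣ) (μ ν : Weight n) :
    weylAct π ε ν ∈ weylOrbit μ ↔ ν ∈ weylOrbit μ := by
  constructor
  · intro h
    obtain ⟨π', ε', h⟩ := mem_weylOrbit.mp h
    rw [← (weylAct π ε).symm_apply_apply ν, ← h, weylAct_symm, weylAct_weylAct]
    exact mem_weylOrbit.mpr ⟨_, _, rfl⟩
  · intro h
    obtain ⟨π', ε', h⟩ := mem_weylOrbit.mp h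
    rw [← h, weylAct_weylAct]
    exact mem_weylOrbit.mpr ⟨_, _, rfl⟩

lemma self_mem_weylOrbit (μ : Weight n) : μ ∈ weylOrbit μ :=
  mem_weylOrbit.mpr ⟨1, 1, by funext i; simp [weylAct_apply]⟩

lemma coeff_orbitSum (μ ν : Weight n) :
    (orbitSum μ).coeff ν = if ν ∈ weylOrbit μ then 1 else 0 := by
  classical
  simp [orbitSum, AddMonoidAlgebra.coeff_sum, Finsupp.finsetSum_apply, Finsupp.single_apply]

/-- Invariance of a Laurent polynomial under signed permutations. -/
def IsWeylInvariant (f : LaurentAlg n) : Prop :=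
  ∀ π ε μ, f.coeff (weylAct π ε μ) = f.coeff μ

lemma isWeylInvariant_orbitSum (μ : Weight n) : IsWeylInvariant (orbitSum μ) := by
  intro π ε ν
  simp only [coeff_orbitSum, weylAct_mem_weylOrbit_iff]

lemma IsWeylInvariant.add {f g : LaurentAlg n} (hf : IsWeylInvariant f) (hg : IsWeylInvariant g) :
    IsWeylInvariant (f + g) := fun π ε μ => by simp [hf π ε μ, hg π ε μ]

lemma IsWeylInvariant.smul {f : LaurentAlg n} (hf : IsWeylInvariant f) (c : ℝ) :
    IsWeylInvariant (c • f) := fun π ε μ => by simp [hf π ε μ]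

lemma IsWeylInvariant.sub {f g : LaurentAlg n} (hf : IsWeylInvariant f) (hg : IsWeylInvariant g) :
    IsWeylInvariant (f - g) := fun π ε μ => by simp [hf π ε μ, hg π ε μ]

/-- Taking absolute values removes the signs, and two decreasing rearrangements of one family agree.
-/
lemma eq_of_isDominant_of_mem_weylOrbit {μ ν : Weight n} (hμ : IsDominant μ) (hν : IsDominant ν)
    (h : ν ∈ weylOrbit μ) : ν = μ := by
  obtain ⟨π, ε, rfl⟩ := mem_weylOrbit.mp h
  have h1 : weylAct π ε μ = μ ∘ π := by
    funext i
    have h2 := congrArg (fun z : ℤ => |z|) (weylAct_apply π ε μ i)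
    simp only [abs_mul, Int.isUnit_iff_abs_eq.mp (ε i).isUnit, one_mul] at h2
    rwa [abs_of_nonneg (hν.2 i), abs_of_nonneg (hμ.2 _)] at h2
  rw [h1] at hν ⊢
  have := Tuple.unique_monotone (f := fun i => -μ i) (σ := π) (τ := 1)
    (fun i j hij => neg_le_neg (hν.1 hij)) (fun i j hij => neg_le_neg (hμ.1 hij))
  funext i
  simpa using congrFun this i

/-- The lexicographically largest weight of a nonzero invariant Laurent polynomial is dominant. -/
lemma IsWeylInvariant.exists_leading {f : LaurentAlg n} (hf : IsWeylInvariant f) (h0 : f ≠ 0) :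
    ∃ κ, f.coeff κ ≠ 0 ∧ IsDominant κ ∧ ∀ μ, f.coeff μ ≠ 0 → toLex μ ≤ toLex κ := by
  have hne : f.coeff.support.Nonempty := by
    rw [Finsupp.support_nonempty_iff]
    simpa using h0
  obtain ⟨κ, hκ, hmax⟩ := Finset.exists_max_image f.coeff.support (fun μ => toLex μ) hne
  have hκ := Finsupp.mem_support_iff.mp hκ
  have hmax : ∀ μ, f.coeff μ ≠ 0 → toLex μ ≤ toLex κ := fun μ hμ =>
    hmax μ (Finsupp.mem_support_iff.mpr hμ)
  refine ⟨κ, hκ, ⟨fun i j hij => ?_, fun i => ?_⟩, hmax⟩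
  -- Moving a larger entry forward, or making a negative entry positive, would give a
  -- lexicographically larger weight in the support.
  · by_contra hlt
    have h1 := hmax (weylAct (Equiv.swap i j) 1 κ) (by rwa [hf])
    have h2 : weylAct (Equiv.swap i j) 1 κ = κ ∘ Equiv.swap i j := by
      funext k
      simp [weylAct_apply]
    have h3 := Pi.lex_desc (f := κ ∘ Equiv.swap i j) hij (by simpa using hlt)
    rw [h2] at h1
    rw [Function.comp_assoc, ← Equiv.coe_trans, Equiv.swap_swap, Equiv.coe_refl,
      Function.comp_id] at h3
    exact absurd h1 (not_le.mpr h3)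
  · by_contra hlt
    have h1 := hmax (weylAct 1 (Function.update 1 i (-1)) κ) (by rwa [hf])
    have h2 : weylAct 1 (Function.update 1 i (-1)) κ = Function.update κ i (-κ i) := by
      funext k
      rcases eq_or_ne k i with rfl | hk
      · simp [weylAct_apply]
      · simp [weylAct_apply, hk]
    rw [h2] at h1
    exact absurd h1 (not_le.mpr (Pi.lt_toLex_update_self_iff.mpr (by omega)))

/-- An invariant Laurent polynomial is a combination of the orbit sums of its dominant weights. -/
lemma IsWeylInvariant.mem_span {S : Weight n → Prop} {f : LaurentAlg n} (hf : IsWeylInvariant f)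
    (hS : ∀ ν, IsDominant ν → f.coeff ν ≠ 0 → S ν) :
    f ∈ Submodule.span ℝ {m | ∃ ν, IsDominant ν ∧ S ν ∧ m = orbitSum ν} := by
  induction hk : f.coeff.support.card using Nat.strong_induction_on generalizing f with
  | _ k ih =>
    by_cases h0 : f = 0
    · rw [h0]
      exact zero_mem _
    obtain ⟨κ, hκ, hdom, -⟩ := hf.exists_leading h0
    -- By invariance the subtraction removes the whole orbit of `κ` and changes nothing else, so the
    -- support shrinks.
    have hc : ∀ μ, (f - f.coeff κ • orbitSum κ).coeff μ =
        if μ ∈ weylOrbit κ then 0 else f.coeff μ := by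
      intro μ
      rw [AddMonoidAlgebra.coeff_sub, AddMonoidAlgebra.coeff_smul, Finsupp.sub_apply,
        Finsupp.smul_apply, coeff_orbitSum]
      split_ifs with h
      · obtain ⟨π, ε, rfl⟩ := mem_weylOrbit.mp h
        simp [hf π ε κ]
      · simp
    have h1 := ih (f - f.coeff κ • orbitSum κ).coeff.support.card ?_
      (hf.sub ((isWeylInvariant_orbitSum κ).smul _)) ?_ rfl
    · have h2 : orbitSum κ ∈ Submodule.span ℝ {m : LaurentAlg n | ∃ ν, IsDominant ν ∧ S ν ∧
          m = orbitSum ν} := Submodule.subset_span ⟨κ, hdom, hS κ hdom hκ, rfl⟩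
      simpa using add_mem h1 (Submodule.smul_mem _ (f.coeff κ) h2)
    · rw [← hk]
      refine Finset.card_lt_card ⟨fun μ hμ => ?_, fun h => ?_⟩
      · rw [Finsupp.mem_support_iff, hc] at hμ
        rw [Finsupp.mem_support_iff]
        split_ifs at hμ
        · exact absurd rfl hμ
        · exact hμ
      · have := h (Finsupp.mem_support_iff.mpr hκ)
        rw [Finsupp.mem_support_iff, hc, if_pos (self_mem_weylOrbit κ)] at this
        exact this rfl
    · intro ν hν hν0
      rw [hc] at hν0
      split_ifs at hν0
      · exact absurd rfl hν0
      · exact hS ν hν hν0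

/-- An element of the span of the orbit sums of a set of dominant weights is invariant, and its
dominant weights belong to the set. -/
lemma isWeylInvariant_of_mem_span {S : Weight n → Prop} {f : LaurentAlg n}
    (hf : f ∈ Submodule.span ℝ {m | ∃ ν, IsDominant ν ∧ S ν ∧ m = orbitSum ν}) :
    IsWeylInvariant f ∧ ∀ ν, IsDominant ν → f.coeff ν ≠ 0 → S ν := by
  induction hf using Submodule.span_induction with
  | mem m hm =>
    obtain ⟨ν, hν, hS, rfl⟩ := hm
    refine ⟨isWeylInvariant_orbitSum ν, fun κ hκ h => ?_⟩
    rw [coeff_orbitSum] at h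
    have : κ ∈ weylOrbit ν := by
      by_contra h'
      simp [h'] at h
    rwa [eq_of_isDominant_of_mem_weylOrbit hν hκ this]
  | zero => exact ⟨fun _ _ _ => by simp, fun _ _ h => by simp at h⟩
  | add f g _ _ hf hg =>
    refine ⟨hf.1.add hg.1, fun ν hν h => ?_⟩
    by_cases h1 : f.coeff ν = 0
    · exact hg.2 ν hν fun h2 => h (by simp [h1, h2])
    · exact hf.2 ν hν h1
  | smul c f _ hf =>
    refine ⟨hf.1.smul c, fun ν hν h => hf.2 ν hν fun h1 => h (by simp [h1])⟩

end WeylGroup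

/-! ### Weights below a one-row weight -/

section Dominance

variable {n : ℕ}

lemma single_sub_single_mem_closure (i : Fin (n + 1)) :
    (Pi.single 0 1 - Pi.single i 1 : Weight (n + 1)) ∈
      AddSubmonoid.closure (simpleRoots (n + 1)) := by
  induction i using Fin.induction with
  | zero => simp
  | succ i ih =>
    have h : (Pi.single i.castSucc 1 - Pi.single i.succ 1 : Weight (n + 1)) ∈
        AddSubmonoid.closure (simpleRoots (n + 1)) :=
      AddSubmonoid.subset_closure (Or.inl ⟨i.castSucc, i.succ, by simp, rfl⟩)
    simpa using add_mem ih h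

/-- 2ε₁ = 2(ε₁ - ε_n) + 2ε_n. -/
lemma single_two_mem_closure :
    (Pi.single 0 2 : Weight (n + 1)) ∈ AddSubmonoid.closure (simpleRoots (n + 1)) := by
  have h1 := single_sub_single_mem_closure (Fin.last n)
  have h2 : (Pi.single (Fin.last n) 2 : Weight (n + 1)) ∈
      AddSubmonoid.closure (simpleRoots (n + 1)) :=
    AddSubmonoid.subset_closure (Or.inr ⟨Fin.last n, by simp, rfl⟩)
  have h3 := add_mem (add_mem h1 h1) h2
  have h4 : (Pi.single 0 2 : Weight (n + 1)) = Pi.single 0 1 + Pi.single 0 1 := by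
    rw [← Pi.single_add]; rfl
  have h5 : (Pi.single (Fin.last n) 2 : Weight (n + 1)) =
      Pi.single (Fin.last n) 1 + Pi.single (Fin.last n) 1 := by
    rw [← Pi.single_add]; rfl
  rw [h5] at h3
  rw [h4]
  convert h3 using 1
  abel

lemma oneRow_eq_single (n r : ℕ) : oneRow (n + 1) r = Pi.single 0 (r : ℤ) := by
  funext i
  rw [oneRow, twoRow]
  rcases eq_or_ne i 0 with rfl | hi
  · simp
  · have hi' : (i : ℕ) ≠ 0 := fun h => hi (Fin.ext h)
    rw [if_neg hi', Pi.single_eq_of_ne hi, ite_self]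

/-- With 2k = r - ∑ ν_i one has rε₁ - ν = ∑ ν_i (ε₁ - ε_i) + k · 2ε₁. -/
lemma weightLT_oneRow {r : ℕ} {ν : Weight (n + 1)} (h0 : ∀ i, 0 ≤ ν i) (hr : ∑ i, ν i ≤ r)
    (hpar : Even ((r : ℤ) - ∑ i, ν i)) (hne : ν ≠ oneRow (n + 1) r) :
    WeightLT ν (oneRow (n + 1) r) := by
  refine ⟨?_, hne⟩
  obtain ⟨k, hk⟩ := hpar
  have hk0 : 0 ≤ k := by omega
  have h1 : oneRow (n + 1) r - ν = (∑ i, (ν i).toNat • (Pi.single 0 1 - Pi.single i 1)) +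
      k.toNat • (Pi.single 0 2 : Weight (n + 1)) := by
    funext j
    rw [oneRow_eq_single]
    simp only [Pi.sub_apply, Pi.add_apply, Finset.sum_apply, Pi.smul_apply]
    simp only [nsmul_eq_mul, Int.toNat_of_nonneg hk0, Int.toNat_of_nonneg (h0 _), mul_sub,
      Finset.sum_sub_distrib]
    rw [Finset.sum_eq_single (f := fun i => ν i * (Pi.single i 1 : Weight (n + 1)) j) j
      (fun i _ hi => by rw [Pi.single_eq_of_ne hi.symm, mul_zero]) (by simp)]
    rcases eq_or_ne j 0 with rfl | hj
    · simp only [Pi.single_eq_same, mul_one]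
      omega
    · simp [hj]
  rw [h1]
  exact add_mem (sum_mem fun i _ => nsmul_mem (single_sub_single_mem_closure i) _)
    (nsmul_mem single_two_mem_closure _)

/-- Simple roots have coordinate sum 0 or 2. -/
lemma sum_nonneg_of_mem_closure {α : Weight n} (h : α ∈ AddSubmonoid.closure (simpleRoots n)) :
    0 ≤ ∑ i, α i := by
  induction h using AddSubmonoid.closure_induction with
  | mem α hα =>
    rcases hα with ⟨i, j, -, rfl⟩ | ⟨i, -, rfl⟩
    · simp
    · simp
  | zero => simp
  | add α β _ _ hα hβ =>
    simp only [Pi.add_apply, Finset.sum_add_distrib]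
    omega

end Dominance

/-! ### Invariance, degree and top coefficient of the one-row polynomials -/

section OneRowStructure

open PowerSeries

/-- A signed permutation permutes the factors of the product that defines the series. -/
lemma map_oneRowPoly_eq_self {n : ℕ} (q t : ℝ) (r : ℕ) (F : LaurentAlg n →ₐ[ℝ] LaurentAlg n)
    (π : Equiv.Perm (Fin n)) (ε : Fin n → ℤˣ)
    (hF : ∀ (i : Fin n) (c : ℤ), F (AddMonoidAlgebra.single (Pi.single (π i) c) 1) =
        AddMonoidAlgebra.single (Pi.single i (((ε i : ℤˣ) : ℤ) * c)) 1) :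
    F (oneRowPoly n q t r) = oneRowPoly n q t r := by
  have h : PowerSeries.map (F : LaurentAlg n →+* LaurentAlg n) (oneRowSeries n q t) =
      oneRowSeries n q t := by
    rw [oneRowSeries, map_pairSeries, pairSeries, ← Equiv.prod_comp π, pairSeries]
    refine Finset.prod_congr rfl fun i _ => ?_
    simp only [hF]
    rcases Int.units_eq_one_or (ε i) with hi | hi <;> rw [hi]
    · simp
    · rw [mul_comm]
      simp
  have h2 := congrArg (coeff r) h
  rwa [coeff_map] at h2

lemma isWeylInvariant_oneRowPoly (n : ℕ) (q t : ℝ) (r : ℕ) :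
    IsWeylInvariant (oneRowPoly n q t r) := by
  intro π ε μ
  have hfix := map_oneRowPoly_eq_self q t r
    (AddMonoidAlgebra.domCongr ℝ ℝ (weylAct π ε)).toAlgHom π ε fun i c => by
      refine (AddMonoidAlgebra.domCongr_single (R := ℝ) (weylAct π ε) _ _).trans ?_
      congr 1
      funext j
      rw [weylAct_apply]
      rcases eq_or_ne j i with rfl | hj
      · simp
      · simp [hj]
  have h := congrArg (fun f : LaurentAlg n => f.coeff (weylAct π ε μ)) hfix
  have h2 := AddMonoidAlgebra.coeff_domCongr (R := ℝ) (weylAct π ε) (oneRowPoly n q t r)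
    (weylAct π ε μ)
  rw [AddEquiv.symm_apply_apply] at h2
  exact h.symm.trans h2

lemma exists_add_of_coeff_mul_ne_zero {n : ℕ} {f g : LaurentAlg n} {κ : Weight n}
    (h : (f * g).coeff κ ≠ 0) : ∃ μ ν, f.coeff μ ≠ 0 ∧ g.coeff ν ≠ 0 ∧ μ + ν = κ := by
  classical
  rw [AddMonoidAlgebra.coeff_mul] at h
  obtain ⟨μ, hμ, h⟩ := Finset.exists_ne_zero_of_sum_ne_zero h
  obtain ⟨ν, hν, h⟩ := Finset.exists_ne_zero_of_sum_ne_zero h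
  refine ⟨μ, ν, Finsupp.mem_support_iff.mp hμ, Finsupp.mem_support_iff.mp hν, ?_⟩
  by_contra h'
  simp [h'] at h

/-- The weights of degree at most `r` with the parity of `r`. -/
def DegreeLE {n : ℕ} (r : ℕ) (μ : Weight n) : Prop :=
  ∑ i, |μ i| ≤ r ∧ Even ((r : ℤ) - ∑ i, μ i)

/-- The `r`-th coefficient of the series only involves weights of degree at most `r`. -/
def DegreeBounded {n : ℕ} (F : (LaurentAlg n)⟦X⟧) : Prop :=
  ∀ r μ, (coeff r F).coeff μ ≠ 0 → DegreeLE r μ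

/-- The series of the coefficients of `x₁ ^ r` in the `r`-th coefficients. -/
noncomputable def topSeries {n : ℕ} (F : (LaurentAlg (n + 1))⟦X⟧) : ℝ⟦X⟧ :=
  PowerSeries.mk fun r => (coeff r F).coeff (Pi.single 0 (r : ℤ))

lemma DegreeLE.add {n : ℕ} {a b : ℕ} {μ ν : Weight n} (hμ : DegreeLE a μ) (hν : DegreeLE b ν) :
    DegreeLE (a + b) (μ + ν) := by
  constructor
  · have h := Finset.sum_le_sum fun (i : Fin n) (_ : i ∈ Finset.univ) => abs_add_le (μ i) (ν i)
    rw [Finset.sum_add_distrib] at h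
    have h1 := hμ.1
    have h2 := hν.1
    push_cast
    exact h.trans (add_le_add h1 h2)
  · have h := hμ.2.add hν.2
    simp only [Pi.add_apply, Finset.sum_add_distrib]
    rw [Nat.cast_add, add_sub_add_comm]
    exact h

lemma DegreeLE.apply_le {n : ℕ} {a : ℕ} {μ : Weight n} (hμ : DegreeLE a μ) (i : Fin n) :
    μ i ≤ a :=
  (le_abs_self _).trans ((Finset.single_le_sum (fun j _ => abs_nonneg (μ j))
    (Finset.mem_univ i)).trans hμ.1)

lemma DegreeLE.eq_single {n : ℕ} {a : ℕ} {μ : Weight n} (hμ : DegreeLE a μ) (i : Fin n)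
    (hi : (a : ℤ) ≤ μ i) : μ = Pi.single i (a : ℤ) := by
  have h1 : μ i = a := le_antisymm (hμ.apply_le i) hi
  funext j
  rcases eq_or_ne j i with rfl | hj
  · simp [h1]
  · have h2 := hμ.1
    have h3 := Finset.sum_le_sum_of_subset_of_nonneg (Finset.subset_univ {i, j})
      fun k _ _ => abs_nonneg (μ k)
    rw [Finset.sum_pair hj.symm, h1, Nat.abs_cast] at h3
    have h4 := abs_nonneg (μ j)
    simp only [Pi.single_eq_of_ne hj]
    exact abs_eq_zero.mp (by omega)

lemma coeff_mul_ne_zero_exists {n : ℕ} {F H : (LaurentAlg n)⟦X⟧} {r : ℕ} {κ : Weight n}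
    (h : (coeff r (F * H)).coeff κ ≠ 0) : ∃ a b, a + b = r ∧
      (coeff a F * coeff b H).coeff κ ≠ 0 := by
  rw [coeff_mul, AddMonoidAlgebra.coeff_sum, Finsupp.finsetSum_apply] at h
  obtain ⟨p, hp, h⟩ := Finset.exists_ne_zero_of_sum_ne_zero h
  exact ⟨p.1, p.2, Finset.HasAntidiagonal.mem_antidiagonal.mp hp, h⟩

lemma DegreeBounded.mul {n : ℕ} {F H : (LaurentAlg n)⟦X⟧} (hF : DegreeBounded F)
    (hH : DegreeBounded H) : DegreeBounded (F * H) := by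
  intro r κ h
  obtain ⟨a, b, rfl, h'⟩ := coeff_mul_ne_zero_exists h
  obtain ⟨μ, ν, hμ, hν, rfl⟩ := exists_add_of_coeff_mul_ne_zero h'
  exact (hF a μ hμ).add (hH b ν hν)

/-- By the degree bounds, x₁^{a+b} arises from degrees a and b only as x₁^a · x₁^b. -/
lemma topSeries_mul {n : ℕ} {F H : (LaurentAlg (n + 1))⟦X⟧} (hF : DegreeBounded F)
    (hH : DegreeBounded H) : topSeries (F * H) = topSeries F * topSeries H := by
  ext r
  rw [topSeries, coeff_mk, coeff_mul, coeff_mul, AddMonoidAlgebra.coeff_sum,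
    Finsupp.finsetSum_apply]
  refine Finset.sum_congr rfl fun p hp => ?_
  have hp := Finset.HasAntidiagonal.mem_antidiagonal.mp hp
  rw [topSeries, topSeries, coeff_mk, coeff_mk]
  have h1 : (Pi.single 0 (r : ℤ) : Weight (n + 1)) =
      Pi.single 0 (p.1 : ℤ) + Pi.single 0 (p.2 : ℤ) := by
    rw [← Pi.single_add, ← hp]; push_cast; rfl
  rw [h1]
  refine AddMonoidAlgebra.coeff_mul_add_of_uniqueAdd fun μ ν hμ hν h => ?_
  have hμ := hF _ _ (Finsupp.mem_support_iff.mp hμ)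
  have hν := hH _ _ (Finsupp.mem_support_iff.mp hν)
  have h2 := congrFun h 0
  simp only [Pi.add_apply, Pi.single_eq_same] at h2
  have h3 := hμ.apply_le 0
  have h4 := hν.apply_le 0
  exact ⟨hμ.eq_single 0 (by omega), hν.eq_single 0 (by omega)⟩

lemma degreeBounded_one {n : ℕ} : DegreeBounded (1 : (LaurentAlg n)⟦X⟧) := by
  intro r μ h
  rw [coeff_one] at h
  split_ifs at h with hr
  · subst hr
    rw [AddMonoidAlgebra.one_def, AddMonoidAlgebra.coeff_single, Finsupp.single_apply] at h
    split_ifs at h with hμ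
    · subst hμ
      simp [DegreeLE]
    · exact absurd rfl h
  · simp at h

lemma topSeries_one {n : ℕ} : topSeries (1 : (LaurentAlg (n + 1))⟦X⟧) = 1 := by
  ext r
  rw [topSeries, coeff_mk, coeff_one, coeff_one]
  split_ifs with hr
  · subst hr
    simp [AddMonoidAlgebra.one_def]
  · simp

lemma coeff_binomSeriesAt_single {n : ℕ} (q t : ℝ) (i : Fin n) (c : ℤ) (r : ℕ) :
    coeff r (binomSeriesAt q t (AddMonoidAlgebra.single (Pi.single i c) 1 : LaurentAlg n)) =
      AddMonoidAlgebra.single (Pi.single i (r * c)) (binomCoeff q t r) := by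
  rw [coeff_binomSeriesAt, AddMonoidAlgebra.single_pow, AddMonoidAlgebra.coe_algebraMap,
    Function.comp, AddMonoidAlgebra.single_mul_single, ← Pi.single_smul]
  simp

lemma degreeBounded_binomSeriesAt {n : ℕ} (q t : ℝ) (i : Fin n) {c : ℤ} (hc : |c| = 1) :
    DegreeBounded (binomSeriesAt q t (AddMonoidAlgebra.single (Pi.single i c) 1 : LaurentAlg n)) := by
  intro r μ h
  rw [coeff_binomSeriesAt_single, AddMonoidAlgebra.coeff_single, Finsupp.single_apply] at h
  split_ifs at h with hμ
  · subst hμ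
    constructor
    · rw [Finset.sum_eq_single i (fun j _ hj => by simp [hj]) (by simp)]
      simp [abs_mul, hc]
    · rw [Finset.sum_eq_single i (fun j _ hj => by simp [hj]) (by simp), Pi.single_eq_same]
      rcases eq_or_eq_neg_of_abs_eq hc with rfl | rfl
      · simp
      · exact ⟨r, by ring⟩
  · exact absurd rfl h

lemma topSeries_binomSeriesAt_of_ne {n : ℕ} (q t : ℝ) {i : Fin (n + 1)} {c : ℤ}
    (h : i ≠ 0 ∨ c < 0) :
    topSeries (binomSeriesAt q t (AddMonoidAlgebra.single (Pi.single i c) 1)) = 1 := by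
  ext r
  rw [topSeries, coeff_mk, coeff_binomSeriesAt_single, AddMonoidAlgebra.coeff_single,
    Finsupp.single_apply, coeff_one]
  rcases Nat.eq_zero_or_pos r with rfl | hr
  · simp [binomCoeff_zero]
  · rw [if_neg hr.ne', if_neg]
    intro h0
    have h1 := congrFun h0 0
    rw [Pi.single_eq_same] at h1
    have hr' : (0 : ℤ) < r := by exact_mod_cast hr
    rcases h with h | h
    · rw [Pi.single_eq_of_ne h.symm] at h1
      omega
    · rcases eq_or_ne i 0 with rfl | hi
      · rw [Pi.single_eq_same] at h1
        nlinarith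
      · rw [Pi.single_eq_of_ne hi.symm] at h1
        omega

lemma topSeries_binomSeriesAt_zero {n : ℕ} (q t : ℝ) :
    topSeries (binomSeriesAt q t (AddMonoidAlgebra.single (Pi.single (0 : Fin (n + 1)) 1) 1)) =
      binomSeries q t := by
  ext r
  rw [topSeries, coeff_mk, coeff_binomSeriesAt_single, AddMonoidAlgebra.coeff_single, mul_one,
    Finsupp.single_eq_same, binomSeries, coeff_mk]

/-- Among all factors only φ(x₁ X) has a top series other than 1. -/
lemma degreeBounded_oneRowSeries_and_topSeries (n : ℕ) (q t : ℝ) :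
    DegreeBounded (oneRowSeries (n + 1) q t) ∧
      topSeries (oneRowSeries (n + 1) q t) = binomSeries q t := by
  set f : Fin (n + 1) → (LaurentAlg (n + 1))⟦X⟧ := fun i =>
    binomSeriesAt q t (AddMonoidAlgebra.single (Pi.single i 1) 1) *
      binomSeriesAt q t (AddMonoidAlgebra.single (Pi.single i (-1)) 1) with hf
  have hb : ∀ i, DegreeBounded (f i) := fun i =>
    (degreeBounded_binomSeriesAt q t i (by simp)).mul (degreeBounded_binomSeriesAt q t i (by simp))
  have ht : ∀ i, topSeries (f i) = if i = 0 then binomSeries q t else 1 := by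
    intro i
    rw [hf, topSeries_mul (degreeBounded_binomSeriesAt q t i (by simp))
      (degreeBounded_binomSeriesAt q t i (by simp)),
      topSeries_binomSeriesAt_of_ne q t (Or.inr (by norm_num) : i ≠ 0 ∨ (-1 : ℤ) < 0), mul_one]
    split_ifs with hi
    · rw [hi, topSeries_binomSeriesAt_zero]
    · exact topSeries_binomSeriesAt_of_ne q t (Or.inl hi)
  have key : ∀ s : Finset (Fin (n + 1)), DegreeBounded (∏ i ∈ s, f i) ∧
      topSeries (∏ i ∈ s, f i) = ∏ i ∈ s, topSeries (f i) := by
    intro s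
    induction s using Finset.induction_on with
    | empty => exact ⟨degreeBounded_one, topSeries_one⟩
    | insert i s hi ih =>
      rw [Finset.prod_insert hi, Finset.prod_insert hi]
      exact ⟨(hb i).mul ih.1, by rw [topSeries_mul (hb i) ih.1, ih.2]⟩
  refine ⟨(key Finset.univ).1, (key Finset.univ).2.trans ?_⟩
  simp [ht]

lemma degreeLE_of_coeff_oneRowPoly_ne_zero {n : ℕ} {q t : ℝ} {r : ℕ} {μ : Weight (n + 1)}
    (h : (oneRowPoly (n + 1) q t r).coeff μ ≠ 0) : DegreeLE r μ :=
  (degreeBounded_oneRowSeries_and_topSeries n q t).1 r μ h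

lemma coeff_oneRowPoly_oneRow (n : ℕ) (q t : ℝ) (r : ℕ) :
    (oneRowPoly (n + 1) q t r).coeff (oneRow (n + 1) r) = binomCoeff q t r := by
  have h := congrArg (coeff r) (degreeBounded_oneRowSeries_and_topSeries n q t).2
  rw [topSeries, coeff_mk, binomSeries, coeff_mk] at h
  rw [oneRow_eq_single, ← h]
  rfl

lemma oneRowPoly_zero (n : ℕ) (q t : ℝ) : oneRowPoly n q t 0 = 1 := by
  have h : ∀ z : LaurentAlg n, constantCoeff (binomSeriesAt q t z) = 1 := fun z => by
    rw [← coeff_zero_eq_constantCoeff_apply, coeff_binomSeriesAt, binomCoeff_zero, pow_zero,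
      map_one, one_mul]
  rw [oneRowPoly, oneRowSeries, pairSeries, coeff_zero_eq_constantCoeff_apply]
  simp [h]

lemma binomCoeff_one (q : ℝ) {r : ℕ} (hr : r ≠ 0) : binomCoeff q 1 r = 0 := by
  obtain ⟨k, rfl⟩ := Nat.exists_eq_succ_of_ne_zero hr
  have : qPoch 1 q (k + 1) = 0 := Finset.prod_eq_zero (Finset.mem_range.mpr k.succ_pos) (by simp)
  rw [binomCoeff, this, zero_div]

lemma oneRowPoly_one (n : ℕ) (q : ℝ) {r : ℕ} (hr : r ≠ 0) : oneRowPoly n q 1 r = 0 := by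
  have h : ∀ z : LaurentAlg n, binomSeriesAt q 1 z = 1 := fun z => by
    ext k
    rw [coeff_binomSeriesAt, coeff_one]
    split_ifs with hk
    · rw [hk, binomCoeff_zero, pow_zero, map_one, one_mul]
    · rw [binomCoeff_one q hk, map_zero, mul_zero]
  rw [oneRowPoly, oneRowSeries, pairSeries]
  simp [h, coeff_one, hr]

end OneRowStructure

/-! ### Values at lexicographic infinity and the eigenvalue of a leading weight -/

section LeadingTerm

variable {n : ℕ}

/-- All weights of the Laurent polynomial are lexicographically at most `0`. -/
def LexNonpos (f : LaurentAlg n) : Prop :=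
  ∀ μ, f.coeff μ ≠ 0 → toLex μ ≤ toLex (0 : Weight n)

lemma LexNonpos.mul {f g : LaurentAlg n} (hf : LexNonpos f) (hg : LexNonpos g) :
    LexNonpos (f * g) := by
  intro κ h
  obtain ⟨μ, ν, hμ, hν, rfl⟩ := exists_add_of_coeff_mul_ne_zero h
  rw [toLex_add, ← add_zero (0 : Weight n), toLex_add]
  exact add_le_add (hf μ hμ) (hg ν hν)

lemma LexNonpos.add {f g : LaurentAlg n} (hf : LexNonpos f) (hg : LexNonpos g) :
    LexNonpos (f + g) := by
  intro κ h
  by_cases h1 : f.coeff κ = 0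
  · exact hg κ fun h2 => h (by simp [h1, h2])
  · exact hf κ h1

lemma lexNonpos_single {μ : Weight n} (hμ : toLex μ ≤ toLex (0 : Weight n)) (c : ℝ) :
    LexNonpos (AddMonoidAlgebra.single μ c) := by
  classical
  intro ν h
  rw [AddMonoidAlgebra.coeff_single, Finsupp.single_apply] at h
  split_ifs at h with h1
  · rwa [← h1]
  · exact absurd rfl h

/-- Two weights that are at most 0 add up to 0 only if both are 0. -/
lemma LexNonpos.coeff_mul_zero {f g : LaurentAlg n} (hf : LexNonpos f) (hg : LexNonpos g) :
    (f * g).coeff 0 = f.coeff 0 * g.coeff 0 := by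
  have h : UniqueAdd f.coeff.support g.coeff.support 0 0 := by
    intro μ ν hμ hν h
    have hμ := hf μ (Finsupp.mem_support_iff.mp hμ)
    have hν := hg ν (Finsupp.mem_support_iff.mp hν)
    have h0 : toLex μ + toLex ν = toLex (0 : Weight n) + toLex (0 : Weight n) := by
      rw [← toLex_add, h, toLex_add]
    have h1 := (add_eq_add_iff_eq_and_eq hμ hν).mp h0
    exact ⟨toLex.injective h1.1, toLex.injective h1.2⟩
  simpa using AddMonoidAlgebra.coeff_mul_add_of_uniqueAdd h

/-- The rational function `z` is regular at infinity in the lexicographic order, with value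
`c` there. -/
def HasResidue (z : RatFun n) (c : ℝ) : Prop :=
  ∃ a b : LaurentAlg n, LexNonpos a ∧ LexNonpos b ∧ a.coeff 0 = c ∧ b.coeff 0 = 1 ∧
    z * algebraMap (LaurentAlg n) (RatFun n) b = algebraMap (LaurentAlg n) (RatFun n) a

lemma HasResidue.unique {z : RatFun n} {c d : ℝ} (hc : HasResidue z c) (hd : HasResidue z d) :
    c = d := by
  obtain ⟨a, b, ha, hb, ha0, hb0, h⟩ := hc
  obtain ⟨a', b', ha', hb', ha0', hb0', h'⟩ := hd
  have h1 : algebraMap (LaurentAlg n) (RatFun n) (a * b') =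
      algebraMap (LaurentAlg n) (RatFun n) (a' * b) := by
    rw [map_mul, map_mul, ← h, ← h']
    ring
  have h2 := IsFractionRing.injective (LaurentAlg n) (RatFun n) h1
  have h3 := congrArg (fun f : LaurentAlg n => f.coeff 0) h2
  simpa only [ha.coeff_mul_zero hb', ha'.coeff_mul_zero hb, ha0, hb0, ha0', hb0', mul_one] using h3

lemma HasResidue.mul {z w : RatFun n} {c d : ℝ} (hc : HasResidue z c) (hd : HasResidue w d) :
    HasResidue (z * w) (c * d) := by
  obtain ⟨a, b, ha, hb, ha0, hb0, h⟩ := hc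
  obtain ⟨a', b', ha', hb', ha0', hb0', h'⟩ := hd
  refine ⟨a * a', b * b', ha.mul ha', hb.mul hb', ?_, ?_, ?_⟩
  · rw [ha.coeff_mul_zero ha', ha0, ha0']
  · rw [hb.coeff_mul_zero hb', hb0, hb0', mul_one]
  · rw [map_mul, map_mul, ← h, ← h']
    ring

lemma HasResidue.add {z w : RatFun n} {c d : ℝ} (hc : HasResidue z c) (hd : HasResidue w d) :
    HasResidue (z + w) (c + d) := by
  obtain ⟨a, b, ha, hb, ha0, hb0, h⟩ := hc
  obtain ⟨a', b', ha', hb', ha0', hb0', h'⟩ := hd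
  refine ⟨a * b' + a' * b, b * b', (ha.mul hb').add (ha'.mul hb), hb.mul hb', ?_, ?_, ?_⟩
  · rw [AddMonoidAlgebra.coeff_add, Finsupp.add_apply, ha.coeff_mul_zero hb',
      ha'.coeff_mul_zero hb, ha0, hb0, ha0', hb0', mul_one, mul_one]
  · rw [hb.coeff_mul_zero hb', hb0, hb0', mul_one]
  · rw [map_add, map_mul, map_mul, map_mul, ← h, ← h']
    ring

lemma lexNonpos_one : LexNonpos (1 : LaurentAlg n) := by
  rw [AddMonoidAlgebra.one_def]
  exact lexNonpos_single le_rfl 1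

lemma coeff_one_zero : (1 : LaurentAlg n).coeff 0 = 1 := by
  rw [AddMonoidAlgebra.one_def, AddMonoidAlgebra.coeff_single, Finsupp.single_eq_same]

lemma hasResidue_algebraMap {f : LaurentAlg n} (hf : LexNonpos f) :
    HasResidue (algebraMap (LaurentAlg n) (RatFun n) f) (f.coeff 0) :=
  ⟨f, 1, hf, lexNonpos_one, rfl, coeff_one_zero, by rw [map_one, mul_one]⟩

lemma hasResidue_prod {ι : Type*} (s : Finset ι) {z : ι → RatFun n} {c : ι → ℝ}
    (h : ∀ i ∈ s, HasResidue (z i) (c i)) : HasResidue (∏ i ∈ s, z i) (∏ i ∈ s, c i) := by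
  classical
  induction s using Finset.induction_on with
  | empty => simpa [coeff_one_zero] using hasResidue_algebraMap (n := n) lexNonpos_one
  | insert i s hi ih =>
    rw [Finset.prod_insert hi, Finset.prod_insert hi]
    exact (h i (Finset.mem_insert_self i s)).mul
      (ih fun j hj => h j (Finset.mem_insert_of_mem hj))

lemma hasResidue_sum {ι : Type*} (s : Finset ι) {z : ι → RatFun n} {c : ι → ℝ}
    (h : ∀ i ∈ s, HasResidue (z i) (c i)) : HasResidue (∑ i ∈ s, z i) (∑ i ∈ s, c i) := by
  classical
  induction s using Finset.induction_on with
  | empty =>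
    have h0 : LexNonpos (0 : LaurentAlg n) := fun _ h => absurd rfl h
    simpa using hasResidue_algebraMap h0
  | insert i s hi ih =>
    rw [Finset.sum_insert hi, Finset.sum_insert hi]
    exact (h i (Finset.mem_insert_self i s)).add
      (ih fun j hj => h j (Finset.mem_insert_of_mem hj))

lemma one_sub_expo_ne_zero {μ : Weight n} (hμ : μ ≠ 0) : 1 - expo μ ≠ 0 := by
  rw [sub_ne_zero, ← expo_zero]
  exact fun h => hμ (expo_injective h).symm

lemma algebraMap_single {μ : Weight n} (c : ℝ) :
    algebraMap (LaurentAlg n) (RatFun n) (AddMonoidAlgebra.single μ c) =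
      algebraMap ℝ (RatFun n) c * expo μ := by
  have h : (AddMonoidAlgebra.single μ c : LaurentAlg n) = c • AddMonoidAlgebra.single μ 1 := by
    rw [AddMonoidAlgebra.smul_single, smul_eq_mul, mul_one]
  rw [h, algebraMap_smul_ratFun, algebraMap_single_eq_expo]

lemma lexNonpos_single_sub {μ : Weight n} (hμ : toLex μ < toLex (0 : Weight n)) (c d : ℝ) :
    LexNonpos (AddMonoidAlgebra.single 0 c - AddMonoidAlgebra.single μ d) := by
  rw [sub_eq_add_neg, ← AddMonoidAlgebra.single_neg]
  exact (lexNonpos_single le_rfl c).add (lexNonpos_single hμ.le (-d))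

lemma coeff_single_sub_zero {μ : Weight n} (hμ : toLex μ < toLex (0 : Weight n)) (c d : ℝ) :
    (AddMonoidAlgebra.single 0 c - AddMonoidAlgebra.single μ d : LaurentAlg n).coeff 0 = c := by
  have : μ ≠ 0 := fun h => hμ.ne (by rw [h])
  simp [this]

lemma hasResidue_factor_neg {μ : Weight n} (hμ : toLex μ < toLex (0 : Weight n)) (t : ℝ) :
    HasResidue ((1 - algebraMap ℝ (RatFun n) t * expo μ) / (1 - expo μ)) 1 := by
  have h0 : μ ≠ 0 := fun h => hμ.ne (by rw [h])
  refine ⟨AddMonoidAlgebra.single 0 1 - AddMonoidAlgebra.single μ t,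
    AddMonoidAlgebra.single 0 1 - AddMonoidAlgebra.single μ 1, lexNonpos_single_sub hμ _ _,
    lexNonpos_single_sub hμ _ _, coeff_single_sub_zero hμ _ _, coeff_single_sub_zero hμ _ _, ?_⟩
  simp only [map_sub, algebraMap_single, map_one, one_mul, expo_zero]
  exact div_mul_cancel₀ _ (one_sub_expo_ne_zero h0)

/-- Multiplying numerator and denominator by x^{-μ} gives (t - x^{-μ})/(1 - x^{-μ}). -/
lemma hasResidue_factor_pos {μ : Weight n} (hμ : toLex (0 : Weight n) < toLex μ) (t : ℝ) :
    HasResidue ((1 - algebraMap ℝ (RatFun n) t * expo μ) / (1 - expo μ)) t := by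
  have h0 : μ ≠ 0 := fun h => hμ.ne (by rw [h])
  have hμ' : toLex (-μ) < toLex (0 : Weight n) := by
    rw [toLex_neg]
    exact neg_lt_zero.mpr hμ
  refine ⟨AddMonoidAlgebra.single 0 t - AddMonoidAlgebra.single (-μ) 1,
    AddMonoidAlgebra.single 0 1 - AddMonoidAlgebra.single (-μ) 1, lexNonpos_single_sub hμ' _ _,
    lexNonpos_single_sub hμ' _ _, coeff_single_sub_zero hμ' _ _, coeff_single_sub_zero hμ' _ _, ?_⟩
  simp only [map_sub, algebraMap_single, map_one, one_mul, expo_zero, expo_neg, mul_one]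
  have h1 := one_sub_expo_ne_zero h0
  have h2 := expo_ne_zero μ
  field_simp
  ring

/-- The sign of a root at infinity is that of its first nonzero entry. The roots whose first entry
sits at `i` are the long one and one for each `j > i`, in number `n - i`. -/
lemma hasResidue_rootWeight (t : ℝ) (σ : Fin n → ℤˣ) :
    HasResidue (rootWeight (algebraMap ℝ (RatFun n) t) (signedPoint (coordFun n) σ))
      (∏ i, (if σ i = 1 then t else 1) ^ (n - (i : ℕ))) := by
  have hfac : ∀ (i : Fin n) (μ : Weight n), (∀ j < i, μ j = 0) →
      (∃ c : ℤ, 0 < c ∧ μ i = c * ((σ i : ℤˣ) : ℤ)) →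
      HasResidue ((1 - algebraMap ℝ (RatFun n) t * expo μ) / (1 - expo μ))
        (if σ i = 1 then t else 1) := by
    rintro i μ hlt ⟨c, hc, hμ⟩
    rcases Int.units_eq_one_or (σ i) with h | h
    · rw [if_pos h]
      refine hasResidue_factor_pos ⟨i, fun j hj => (hlt j hj).symm, ?_⟩ t
      simpa [hμ, h] using hc
    · rw [if_neg (by rw [h]; decide)]
      refine hasResidue_factor_neg ⟨i, fun j hj => hlt j hj, ?_⟩ t
      simpa [hμ, h] using hc
  have h1 : (∏ i, (if σ i = 1 then t else 1) ^ (n - (i : ℕ))) =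
      (∏ i, if σ i = 1 then t else 1) *
        ∏ i, ∏ _j ∈ Finset.Ioi i, if σ i = 1 then t else 1 := by
    rw [← Finset.prod_mul_distrib]
    refine Finset.prod_congr rfl fun i _ => ?_
    rw [Finset.prod_const, Fin.card_Ioi, ← pow_succ']
    congr 1
    omega
  rw [h1, rootWeight]
  refine (hasResidue_prod _ fun i _ => ?_).mul
    (hasResidue_prod _ fun i _ => hasResidue_prod _ fun j hj => ?_)
  · rw [signedPoint, coordFun_zpow, pow_two, ← expo_add]
    refine hfac i _ (fun j hj => by simp [hj.ne]) ⟨2, by norm_num, by simp; ring⟩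
  · rw [signedPoint, signedPoint, coordFun_zpow, coordFun_zpow, ← expo_add]
    have hij := Finset.mem_Ioi.mp hj
    refine hfac i _ (fun k hk => by simp [hk.ne, (hk.trans hij).ne])
      ⟨1, by norm_num, by simp [hij.ne]⟩

lemma coeff_shiftHom {q : ℝ} (hq : 0 < q) (σ : Fin n → ℤˣ) (f : LaurentAlg n) (μ : Weight n) :
    (shiftHom hq σ f).coeff μ =
      Real.sqrt q ^ (∑ i, ((σ i : ℤˣ) : ℤ) * μ i) * f.coeff μ := by
  classical
  induction f using AddMonoidAlgebra.induction_linear with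
  | zero => simp
  | add f g hf hg => simp [hf, hg, mul_add]
  | single ν c =>
    rw [shiftHom_single, AddMonoidAlgebra.coeff_single, AddMonoidAlgebra.coeff_single,
      Finsupp.single_apply, Finsupp.single_apply]
    split_ifs with h
    · rw [h]
    · rw [mul_zero]

lemma coeff_single_neg_mul (κ : Weight n) (f : LaurentAlg n) (μ : Weight n) :
    (AddMonoidAlgebra.single (-κ) 1 * f : LaurentAlg n).coeff μ = f.coeff (κ + μ) := by
  rw [AddMonoidAlgebra.coeff_single_mul_eq_mul_coeff (κ + μ), one_mul]
  intro ν _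
  constructor
  · rintro rfl
    abel
  · rintro rfl
    abel

lemma eigen_eq_sum (q t : ℝ) {κ : Weight n} (hq : 0 < q) :
    eigen q t κ = ∑ σ : Fin n → ℤˣ, (∏ i, (if σ i = 1 then t else 1) ^ (n - (i : ℕ))) *
      Real.sqrt q ^ (∑ i, ((σ i : ℤˣ) : ℤ) * κ i) := by
  have hs : Real.sqrt q ≠ 0 := (Real.sqrt_pos.mpr hq).ne'
  have h1 : eigen q t κ = ∏ i : Fin n, ∑ τ : ℤˣ,
      (if τ = 1 then t else 1) ^ (n - (i : ℕ)) * Real.sqrt q ^ (((τ : ℤˣ) : ℤ) * κ i) := by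
    refine Finset.prod_congr rfl fun i _ => ?_
    rw [UnitsInt.univ, Finset.sum_pair (by decide), if_pos rfl, if_neg (by decide)]
    simp [mul_comm]
  rw [h1, Finset.prod_univ_sum, Fintype.piFinset_univ]
  refine Finset.sum_congr rfl fun σ _ => ?_
  have h2 : Real.sqrt q ^ (∑ i, ((σ i : ℤˣ) : ℤ) * κ i) =
      ∏ i, Real.sqrt q ^ (((σ i : ℤˣ) : ℤ) * κ i) := by
    induction (Finset.univ : Finset (Fin n)) using Finset.induction_on with
    | empty => simp
    | insert i s hi ih => rw [Finset.sum_insert hi, Finset.prod_insert hi, zpow_add₀ hs, ih]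
  rw [Finset.prod_mul_distrib, h2]

/-- An eigenvalue of the Macdonald operator is determined by the leading weight of the
eigenvector. -/
theorem eq_eigen_of_leading {q t c : ℝ} (hq : 0 < q) {f : LaurentAlg n} {κ : Weight n}
    (hκ : f.coeff κ ≠ 0) (hmax : ∀ μ, f.coeff μ ≠ 0 → toLex μ ≤ toLex κ)
    (hf : macdonaldE q t f = algebraMap (LaurentAlg n) (RatFun n) (c • f)) :
    c = eigen q t κ := by
  have hsh : ∀ g : LaurentAlg n, (∀ μ, g.coeff μ ≠ 0 → toLex μ ≤ toLex κ) →
      HasResidue (expo (-κ) * algebraMap (LaurentAlg n) (RatFun n) g) (g.coeff κ) := by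
    intro g hg
    have h1 : LexNonpos (AddMonoidAlgebra.single (-κ) 1 * g) := by
      intro μ h
      rw [coeff_single_neg_mul] at h
      have h2 := hg _ h
      rw [toLex_add] at h2
      simpa using h2
    have h2 := hasResidue_algebraMap h1
    rwa [coeff_single_neg_mul, add_zero, map_mul] at h2
  have h1 : HasResidue (expo (-κ) * macdonaldE q t f) (c * f.coeff κ) := by
    rw [hf]
    refine hsh (c • f) fun μ h => hmax μ fun h0 => h (by simp [h0])
  -- Translations only rescale coefficients, so each term has a value at infinity; the values add up
  -- to the expanded product of the eigenvalue.
  have h2 : HasResidue (expo (-κ) * macdonaldE q t f) (eigen q t κ * f.coeff κ) := by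
    rw [macdonaldE_eq hq, eigen_eq_sum q t hq, Finset.mul_sum, Finset.sum_mul]
    refine hasResidue_sum _ fun σ _ => ?_
    rw [mul_left_comm, mul_assoc]
    refine (hasResidue_rootWeight t σ).mul ?_
    rw [← coeff_shiftHom hq]
    refine hsh _ fun μ h => hmax μ fun h0 => h (by rw [coeff_shiftHom, h0, mul_zero])
  exact mul_right_cancel₀ hκ (h1.unique h2)

end LeadingTerm

/-! ### Comparison of eigenvalues for t ≤ 1 -/

section Genericity

/-- The `i`-th factor of the eigenvalue, as a function of the `i`-th entry of the weight. -/
noncomputable def eigenFactor (q t : ℝ) (n i : ℕ) (a : ℤ) : ℝ :=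
  Real.sqrt q ^ a * t ^ (n - i) + Real.sqrt q ^ (-a)

variable {q t : ℝ}

lemma eigenFactor_pos (hq : 0 < q) (ht : 0 < t) (n i : ℕ) (a : ℤ) : 0 < eigenFactor q t n i a := by
  have := Real.sqrt_pos.mpr hq
  unfold eigenFactor
  positivity

/-- The change when an entry `b` at place `i` is moved onto the first entry `a`. For `a, b ≥ 0` and
`t ≤ 1` both factors on the right are nonnegative. -/
lemma eigenFactor_mul_sub (hq : 0 < q) (n i : ℕ) (a b : ℤ) :
    eigenFactor q t n 0 (a + b) * eigenFactor q t n i 0 -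
        eigenFactor q t n 0 a * eigenFactor q t n i b =
      (Real.sqrt q ^ (-b) - Real.sqrt q ^ b) *
        (Real.sqrt q ^ (-a) * t ^ (n - i) - Real.sqrt q ^ a * t ^ n) := by
  have hs : Real.sqrt q ≠ 0 := (Real.sqrt_pos.mpr hq).ne'
  simp only [eigenFactor, neg_add, zpow_add₀ hs, neg_zero, zpow_zero, Nat.sub_zero]
  ring

lemma zpow_sqrt_le_one (hq1 : q < 1) {a : ℤ} (ha : 0 ≤ a) : Real.sqrt q ^ a ≤ 1 := by
  lift a to ℕ using ha
  rw [zpow_natCast]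
  exact pow_le_one₀ (Real.sqrt_nonneg q) (Real.sqrt_le_one.mpr hq1.le)

lemma zpow_sqrt_lt_one (hq1 : q < 1) {a : ℤ} (ha : 0 < a) : Real.sqrt q ^ a < 1 := by
  lift a to ℕ using ha.le
  rw [zpow_natCast]
  refine pow_lt_one₀ (Real.sqrt_nonneg q) ?_ (by omega)
  rw [Real.sqrt_lt' one_pos]
  simpa using hq1

lemma eigenFactor_mul_le (hq0 : 0 < q) (hq1 : q < 1) (ht0 : 0 < t) (ht1 : t ≤ 1) (n i : ℕ) {a b : ℤ}
    (ha : 0 ≤ a) (hb : 0 ≤ b) :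
    eigenFactor q t n 0 a * eigenFactor q t n i b ≤
      eigenFactor q t n 0 (a + b) * eigenFactor q t n i 0 := by
  have hs := Real.sqrt_pos.mpr hq0
  rw [← sub_nonneg, eigenFactor_mul_sub hq0]
  have h1 := zpow_sqrt_le_one hq1 ha
  have h2 := zpow_sqrt_le_one hq1 hb
  have h3 : t ^ n ≤ t ^ (n - i) := pow_le_pow_of_le_one ht0.le ht1 (Nat.sub_le n i)
  have h4 : 1 ≤ Real.sqrt q ^ (-a) := by
    rw [zpow_neg]; exact (one_le_inv₀ (zpow_pos hs a)).mpr h1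
  have h5 : 1 ≤ Real.sqrt q ^ (-b) := by
    rw [zpow_neg]; exact (one_le_inv₀ (zpow_pos hs b)).mpr h2
  refine mul_nonneg (by linarith) (sub_nonneg.mpr ?_)
  exact mul_le_mul (h1.trans h4) h3 (pow_pos ht0 n).le (zpow_pos hs _).le

lemma eigenFactor_mul_lt (hq0 : 0 < q) (hq1 : q < 1) (ht0 : 0 < t) (ht1 : t ≤ 1) (n i : ℕ) {a b : ℤ}
    (ha : 0 < a) (hb : 0 < b) :
    eigenFactor q t n 0 a * eigenFactor q t n i b <
      eigenFactor q t n 0 (a + b) * eigenFactor q t n i 0 := by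
  have hs := Real.sqrt_pos.mpr hq0
  rw [← sub_pos, eigenFactor_mul_sub hq0]
  have h1 := zpow_sqrt_lt_one hq1 ha
  have h2 := zpow_sqrt_lt_one hq1 hb
  have h3 : t ^ n ≤ t ^ (n - i) := pow_le_pow_of_le_one ht0.le ht1 (Nat.sub_le n i)
  have h4 : 1 < Real.sqrt q ^ (-a) := by
    rw [zpow_neg]; exact (one_lt_inv₀ (zpow_pos hs a)).mpr h1
  have h5 : 1 < Real.sqrt q ^ (-b) := by
    rw [zpow_neg]; exact (one_lt_inv₀ (zpow_pos hs b)).mpr h2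
  refine mul_pos (by linarith) (sub_pos.mpr ?_)
  exact mul_lt_mul (h1.trans h4) h3 (pow_pos ht0 n) (zpow_pos hs _).le

lemma eigenFactor_lt (hq0 : 0 < q) (hq1 : q < 1) (ht0 : 0 < t) (ht1 : t ≤ 1) (n : ℕ) {a b : ℤ}
    (ha : 0 ≤ a) (hab : a < b) : eigenFactor q t n 0 a < eigenFactor q t n 0 b := by
  have hs := Real.sqrt_pos.mpr hq0
  have hb := zpow_sqrt_lt_one hq1 (ha.trans_lt hab)
  have h1 := zpow_sqrt_le_one hq1 ha
  have h2 : Real.sqrt q ^ b < Real.sqrt q ^ a := by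
    have h3 := zpow_sqrt_lt_one hq1 (sub_pos.mpr hab)
    have h4 : Real.sqrt q ^ b = Real.sqrt q ^ a * Real.sqrt q ^ (b - a) := by
      rw [← zpow_add₀ hs.ne']; congr 1; ring
    rw [h4]
    exact mul_lt_of_lt_one_right (zpow_pos hs a) h3
  have hA := zpow_pos hs a
  have hB := zpow_pos hs b
  simp only [eigenFactor, zpow_neg, Nat.sub_zero]
  generalize Real.sqrt q ^ a = A at *
  generalize Real.sqrt q ^ b = B at *
  have hu : t ^ n ≤ 1 := pow_le_one₀ ht0.le ht1
  have h3 : A⁻¹ * B⁻¹ > 1 := by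
    rw [← mul_inv]
    refine (one_lt_inv₀ (mul_pos hA hB)).mpr ?_
    exact mul_lt_one_of_nonneg_of_lt_one_right h1 hB.le hb
  have h4 : B⁻¹ - A⁻¹ = (A - B) * (A⁻¹ * B⁻¹) := by
    field_simp
  nlinarith [mul_pos (sub_pos.mpr h2) (sub_pos.mpr (hu.trans_lt h3))]

lemma eigen_eq_prod (n : ℕ) (ν : Weight n) :
    eigen q t ν = ∏ i : Fin n, eigenFactor q t n i (ν i) := rfl

/-- All entries in `s` are moved to the first place one at a time. -/
lemma eigenFactor_mul_prod_le (hq0 : 0 < q) (hq1 : q < 1) (ht0 : 0 < t) (ht1 : t ≤ 1) {n : ℕ}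
    {ν : Weight n} (hν : ∀ i, 0 ≤ ν i) (s : Finset (Fin n)) {a : ℤ} (ha : 0 ≤ a) :
    eigenFactor q t n 0 a * ∏ i ∈ s, eigenFactor q t n i (ν i) ≤
      eigenFactor q t n 0 (a + ∑ i ∈ s, ν i) * ∏ i ∈ s, eigenFactor q t n i 0 := by
  induction s using Finset.induction_on generalizing a with
  | empty => simp
  | insert j s hj ih =>
    rw [Finset.prod_insert hj, Finset.prod_insert hj, Finset.sum_insert hj, ← mul_assoc]
    calc _ ≤ eigenFactor q t n 0 (a + ν j) * eigenFactor q t n j 0 *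
          ∏ i ∈ s, eigenFactor q t n i (ν i) :=
          mul_le_mul_of_nonneg_right (eigenFactor_mul_le hq0 hq1 ht0 ht1 n j ha (hν j))
            (Finset.prod_nonneg fun i _ => (eigenFactor_pos hq0 ht0 _ _ _).le)
      _ = (eigenFactor q t n 0 (a + ν j) * ∏ i ∈ s, eigenFactor q t n i (ν i)) *
          eigenFactor q t n j 0 := by ring
      _ ≤ (eigenFactor q t n 0 (a + ν j + ∑ i ∈ s, ν i) * ∏ i ∈ s, eigenFactor q t n i 0) *
          eigenFactor q t n j 0 :=
          mul_le_mul_of_nonneg_right (ih (add_nonneg ha (hν j))) (eigenFactor_pos hq0 ht0 _ _ _).le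
      _ = _ := by rw [add_assoc]; ring

/-- For `t ≤ 1` the eigenvalue of a one-row weight exceeds those of all smaller dominant
weights. -/
lemma eigen_lt_eigen_oneRow (hq0 : 0 < q) (hq1 : q < 1) (ht0 : 0 < t) (ht1 : t ≤ 1) {n r : ℕ}
    {ν : Weight (n + 1)} (hν : IsDominant ν) (hlt : WeightLT ν (oneRow (n + 1) r)) :
    eigen q t ν < eigen q t (oneRow (n + 1) r) := by
  have hsum : ν 0 + ∑ i ∈ Finset.univ.erase 0, ν i ≤ r := by
    rw [Finset.add_sum_erase _ _ (Finset.mem_univ 0)]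
    have h := sum_nonneg_of_mem_closure hlt.1
    simp only [Pi.sub_apply, Finset.sum_sub_distrib, oneRow_eq_single, Finset.sum_pi_single',
      Finset.mem_univ, if_true] at h
    omega
  have hr : eigen q t (oneRow (n + 1) r) = eigenFactor q t (n + 1) 0 r *
      ∏ i ∈ Finset.univ.erase (0 : Fin (n + 1)), eigenFactor q t (n + 1) i 0 := by
    rw [eigen_eq_prod, ← Finset.mul_prod_erase _ _ (Finset.mem_univ 0), oneRow_eq_single]
    refine congrArg₂ (· * ·) (by rw [Pi.single_eq_same]; rfl) (Finset.prod_congr rfl fun i hi => ?_)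
    rw [Pi.single_eq_of_ne (Finset.ne_of_mem_erase hi)]
  have hl : eigen q t ν = eigenFactor q t (n + 1) 0 (ν 0) *
      ∏ i ∈ Finset.univ.erase (0 : Fin (n + 1)), eigenFactor q t (n + 1) i (ν i) := by
    rw [eigen_eq_prod, ← Finset.mul_prod_erase _ _ (Finset.mem_univ 0)]
    rfl
  have hpos : ∀ s : Finset (Fin (n + 1)), ∀ μ : Weight (n + 1),
      0 < ∏ i ∈ s, eigenFactor q t (n + 1) i (μ i) := fun s μ =>
    Finset.prod_pos fun i _ => eigenFactor_pos hq0 ht0 _ _ _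
  rw [hl, hr]
  -- Strictness has two sources. If the degree is below r, the first factor increases strictly.
  -- Otherwise some entry outside the first place is positive; by dominance so is the first, and
  -- moving that entry is a strict step.
  rcases hsum.lt_or_eq with h | h
  · refine (eigenFactor_mul_prod_le hq0 hq1 ht0 ht1 hν.2 _ (hν.2 0)).trans_lt ?_
    exact mul_lt_mul_of_pos_right (eigenFactor_lt hq0 hq1 ht0 ht1 _
      (add_nonneg (hν.2 0) (Finset.sum_nonneg fun i _ => hν.2 i)) h) (hpos _ 0)
  · obtain ⟨j, hj0, hj⟩ : ∃ j : Fin (n + 1), j ≠ 0 ∧ 0 < ν j := by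
      by_contra! hno
      have h0 : ∀ j, j ≠ 0 → ν j = 0 := fun j hj => le_antisymm (hno j hj) (hν.2 j)
      refine hlt.2 ?_
      rw [oneRow_eq_single, ← h, Finset.sum_eq_zero fun i hi => h0 i (Finset.ne_of_mem_erase hi),
        add_zero]
      funext i
      rcases eq_or_ne i 0 with rfl | hi
      · simp
      · simp [hi, h0 i hi]
    have hjm : j ∈ Finset.univ.erase (0 : Fin (n + 1)) := Finset.mem_erase.mpr ⟨hj0, Finset.mem_univ j⟩
    rw [← Finset.add_sum_erase _ _ hjm, ← add_assoc] at h
    rw [← Finset.mul_prod_erase _ _ hjm, ← Finset.mul_prod_erase _ _ hjm, ← mul_assoc, ← h]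
    calc _ < eigenFactor q t (n + 1) 0 (ν 0 + ν j) * eigenFactor q t (n + 1) j 0 *
          ∏ i ∈ (Finset.univ.erase 0).erase j, eigenFactor q t (n + 1) i (ν i) :=
          mul_lt_mul_of_pos_right (eigenFactor_mul_lt hq0 hq1 ht0 ht1 _ _
            (hj.trans_le (hν.1 (Fin.zero_le j))) hj) (hpos _ ν)
      _ = eigenFactor q t (n + 1) j 0 * (eigenFactor q t (n + 1) 0 (ν 0 + ν j) *
          ∏ i ∈ (Finset.univ.erase 0).erase j, eigenFactor q t (n + 1) i (ν i)) := by ring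
      _ ≤ eigenFactor q t (n + 1) j 0 * (eigenFactor q t (n + 1) 0
          (ν 0 + ν j + ∑ i ∈ (Finset.univ.erase 0).erase j, ν i) *
          ∏ i ∈ (Finset.univ.erase 0).erase j, eigenFactor q t (n + 1) i 0) :=
          mul_le_mul_of_nonneg_left (eigenFactor_mul_prod_le hq0 hq1 ht0 ht1 hν.2 _
            (add_nonneg (hν.2 0) (hν.2 j))) (eigenFactor_pos hq0 ht0 _ _ _).le
      _ = _ := by ring

end Genericity

/-! ### One-row polynomials do not vanish when t is a negative power of q -/

section NonVanishing

open PowerSeries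

/-- All coefficients are nonnegative, and those of index at most `N` are positive. -/
def PositiveUpTo (N : ℕ) (F : ℝ⟦X⟧) : Prop :=
  (∀ k, 0 ≤ coeff k F) ∧ ∀ k ≤ N, 0 < coeff k F

lemma PositiveUpTo.mul {M N : ℕ} {F H : ℝ⟦X⟧} (hF : PositiveUpTo M F) (hH : PositiveUpTo N H) :
    PositiveUpTo (M + N) (F * H) := by
  refine ⟨fun k => ?_, fun k hk => ?_⟩
  · rw [coeff_mul]
    exact Finset.sum_nonneg fun p _ => mul_nonneg (hF.1 _) (hH.1 _)
  · rw [coeff_mul]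
    refine Finset.sum_pos' (fun p _ => mul_nonneg (hF.1 _) (hH.1 _))
      ⟨(min k M, k - min k M), ?_, mul_pos (hF.2 _ (min_le_right _ _)) (hH.2 _ (by omega))⟩
    rw [Finset.HasAntidiagonal.mem_antidiagonal]
    simp

lemma PositiveUpTo.pow {M : ℕ} {F : ℝ⟦X⟧} (hF : PositiveUpTo M F) (k : ℕ) :
    PositiveUpTo (k * M) (F ^ k) := by
  induction k with
  | zero =>
    refine ⟨fun k => ?_, fun k hk => ?_⟩
    · rw [pow_zero, coeff_one]
      split_ifs <;> norm_num
    · have : k = 0 := by omega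
      simp [this]
  | succ k ih =>
    rw [pow_succ, add_mul, one_mul]
    exact ih.mul hF

lemma qPoch_self_pos {q : ℝ} (hq0 : 0 < q) (hq1 : q < 1) (r : ℕ) : 0 < qPoch q q r := by
  refine Finset.prod_pos fun j _ => ?_
  rw [← pow_succ']
  exact sub_pos.mpr (pow_lt_one₀ hq0.le hq1 (Nat.succ_ne_zero j))

/-- For t = q^{-j} the coefficients of φ(-X) are ∏ (t q^i - 1)/(q;q)_k: positive for k ≤ j, zero
beyond. -/
lemma positiveUpTo_binomSeriesAt {q t : ℝ} (hq0 : 0 < q) (hq1 : q < 1) (ht : 0 < t) {j : ℕ}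
    (hj : t * q ^ j = 1) : PositiveUpTo j (binomSeriesAt q t (-1 : ℝ)) := by
  have hc : ∀ k, coeff k (binomSeriesAt q t (-1 : ℝ)) =
      (∏ i ∈ Finset.range k, (t * q ^ i - 1)) / qPoch q q k := by
    intro k
    rw [coeff_binomSeriesAt, binomCoeff, Algebra.algebraMap_self_apply, ← mul_div_assoc]
    congr 1
    have : (-1 : ℝ) ^ k = ∏ _i ∈ Finset.range k, (-1 : ℝ) := by simp
    rw [this, qPoch, ← Finset.prod_mul_distrib]
    exact Finset.prod_congr rfl fun i _ => by ring
  have hpos : ∀ k ≤ j, 0 < coeff k (binomSeriesAt q t (-1 : ℝ)) := by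
    intro k hk
    rw [hc]
    refine div_pos (Finset.prod_pos fun i hi => sub_pos.mpr ?_) (qPoch_self_pos hq0 hq1 k)
    rw [← hj]
    exact mul_lt_mul_of_pos_left (pow_lt_pow_right_of_lt_one₀ hq0 hq1
      ((Finset.mem_range.mp hi).trans_le hk)) ht
  refine ⟨fun k => ?_, hpos⟩
  rcases le_or_gt k j with hk | hk
  · exact (hpos k hk).le
  · rw [hc, Finset.prod_eq_zero (Finset.mem_range.mpr hk) (by rw [hj, sub_self]), zero_div]

/-- The specialization of all variables at `-1`. -/
noncomputable def evalNegOne (n : ℕ) : LaurentAlg n →ₐ[ℝ] ℝ :=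
  AddMonoidAlgebra.lift ℝ ℝ (Weight n)
    { toFun := fun μ => (-1 : ℝ) ^ (∑ i, μ.toAdd i)
      map_one' := by simp
      map_mul' := fun μ ν => by
        rw [← zpow_add₀ (by norm_num), ← Finset.sum_add_distrib]
        simp }

lemma evalNegOne_single {n : ℕ} (i : Fin n) (c : ℤ) :
    evalNegOne n (AddMonoidAlgebra.single (Pi.single i c) 1) = (-1) ^ c := by
  rw [evalNegOne, AddMonoidAlgebra.lift_single]
  simp

/-- With all x_i = -1 the series becomes φ(-X)^{2n}, whose coefficients are positive up to degree
2nj ≥ j + 1. -/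
lemma oneRowPoly_ne_zero {n : ℕ} (hn : 0 < n) {q t : ℝ} (hq0 : 0 < q) (hq1 : q < 1) (ht : 0 < t)
    {j : ℕ} (hj0 : 0 < j) (hj : t * q ^ j = 1) : oneRowPoly n q t (j + 1) ≠ 0 := by
  have h1 : PowerSeries.map (evalNegOne n : LaurentAlg n →+* ℝ) (oneRowSeries n q t) =
      (binomSeriesAt q t (-1 : ℝ) * binomSeriesAt q t (-1 : ℝ)) ^ n := by
    rw [oneRowSeries, map_pairSeries, pairSeries]
    simp [evalNegOne_single]
  have h2 := positiveUpTo_binomSeriesAt hq0 hq1 ht hj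
  have h3 := ((h2.mul h2).pow n).2 (j + 1) (by nlinarith)
  rw [← h1, coeff_map] at h3
  intro h0
  rw [show coeff (j + 1) (oneRowSeries n q t) = 0 from h0, map_zero] at h3
  exact lt_irrefl _ h3

end NonVanishing

/-! ### Existence and uniqueness, and the identification with the one-row polynomials -/

section Existence

variable {n : ℕ} {q t : ℝ}

/-- The product formula with second index 0, where both sums are empty. -/
lemma macdonaldE_oneRowPoly (hn : 2 ≤ n) (hq0 : 0 < q) (hq1 : q < 1) (ht : 0 < t) (r : ℕ) :
    macdonaldE q t (oneRowPoly n q t r) =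
      algebraMap (LaurentAlg n) (RatFun n) (eigen q t (oneRow n r) • oneRowPoly n q t r) := by
  have h := macdonaldE_oneRowPoly_mul hn hq0 hq1 ht (Nat.zero_le r)
  simpa [oneRowPoly_zero, oneRow] using h

lemma isDominant_oneRow (n r : ℕ) : IsDominant (oneRow (n + 1) r) := by
  rw [oneRow_eq_single]
  have h : ∀ i, (0 : ℤ) ≤ (Pi.single 0 (r : ℤ) : Weight (n + 1)) i := fun i => by
    rw [Pi.single_apply]
    split_ifs <;> simp
  refine ⟨fun i j hij => ?_, h⟩
  rcases eq_or_ne j 0 with rfl | hj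
  · rw [Fin.le_zero_iff.mp hij]
  · rw [Pi.single_eq_of_ne hj]
    exact h i

lemma weightLT_of_degreeLE {r : ℕ} {ν : Weight (n + 1)} (hν : IsDominant ν) (h : DegreeLE r ν)
    (hne : ν ≠ oneRow (n + 1) r) : WeightLT ν (oneRow (n + 1) r) := by
  refine weightLT_oneRow hν.2 ?_ h.2 hne
  refine le_trans (le_of_eq ?_) h.1
  exact Finset.sum_congr rfl fun i _ => (abs_of_nonneg (hν.2 i)).symm

/-- A zero means t q^j = 1 with 0 < j < r, hence t > 1. Then the nonzero eigenvector g_{j+1} has no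
term at (j+1)ε₁, so its leading weight is a smaller dominant weight with the same eigenvalue, which
genericity excludes. -/
lemma binomCoeff_ne_zero (hn : 2 ≤ n) (hq0 : 0 < q) (hq1 : q < 1) (ht : 0 < t) (ht1 : t ≠ 1)
    {N : ℕ} (hgen : 1 < t → ∀ r : ℕ, r ≤ N → ∀ μ : Weight n, IsDominant μ →
      WeightLT μ (oneRow n r) → eigen q t μ ≠ eigen q t (oneRow n r)) {r : ℕ} (hr : r ≤ N) :
    binomCoeff q t r ≠ 0 := by
  refine div_ne_zero (fun h0 => ?_) (qPoch_self_ne_zero hq0 hq1 r)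
  obtain ⟨j, hj, h0⟩ := Finset.prod_eq_zero_iff.mp h0
  have hj := Finset.mem_range.mp hj
  have hjt : t * q ^ j = 1 := (sub_eq_zero.mp h0).symm
  have hj0 : j ≠ 0 := by
    rintro rfl
    exact ht1 (by simpa using hjt)
  have ht' : 1 < t := by
    by_contra hle
    have := pow_lt_one₀ hq0.le hq1 hj0
    nlinarith [pow_pos hq0 j]
  obtain ⟨m, rfl⟩ : ∃ m, n = m + 1 := ⟨n - 1, by omega⟩
  obtain ⟨κ, hκ, hdom, hmax⟩ := (isWeylInvariant_oneRowPoly (m + 1) q t (j + 1)).exists_leading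
    (oneRowPoly_ne_zero (by omega) hq0 hq1 ht (Nat.pos_of_ne_zero hj0) hjt)
  refine hgen ht' (j + 1) (by omega) κ hdom
    (weightLT_of_degreeLE hdom (degreeLE_of_coeff_oneRowPoly_ne_zero hκ) ?_)
    (eq_eigen_of_leading hq0 hκ hmax (macdonaldE_oneRowPoly hn hq0 hq1 ht (j + 1))).symm
  rintro rfl
  refine hκ ?_
  rw [coeff_oneRowPoly_oneRow, binomCoeff,
    show qPoch t q (j + 1) = 0 from Finset.prod_eq_zero (Finset.self_mem_range_succ j) h0, zero_div]

/-- A nonzero difference would be an eigenvector for e_μ whose leading weight is dominant and below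
μ. -/
lemma IsMacdonald.eq_of_generic (hq : 0 < q) {μ : Weight n}
    (hgen : ∀ ν : Weight n, IsDominant ν → WeightLT ν μ → eigen q t ν ≠ eigen q t μ)
    {P P' : LaurentAlg n} (hP : IsMacdonald q t μ P) (hP' : IsMacdonald q t μ P') : P = P' := by
  by_contra hne
  have hspan := sub_mem hP.1 hP'.1
  rw [sub_sub_sub_cancel_right] at hspan
  obtain ⟨hinv, hS⟩ := isWeylInvariant_of_mem_span hspan
  obtain ⟨κ, hκ, hdom, hmax⟩ := hinv.exists_leading (sub_ne_zero.mpr hne)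
  have hE : macdonaldE q t (P - P') =
      algebraMap (LaurentAlg n) (RatFun n) (eigen q t μ • (P - P')) := by
    rw [sub_eq_add_neg, ← neg_one_smul ℝ P', macdonaldE_add hq, macdonaldE_smul hq, hP.2, hP'.2]
    simp only [smul_add, map_add, smul_comm _ (-1 : ℝ)]
    rw [algebraMap_smul_ratFun (-1), Algebra.smul_def (-1 : ℝ)]
  exact hgen κ hdom (hS κ hdom hκ) (eq_eigen_of_leading hq hκ hmax hE).symm

lemma isMacdonald_smul_oneRowPoly (hn : 2 ≤ n) (hq0 : 0 < q) (hq1 : q < 1) (ht : 0 < t) {r : ℕ}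
    (hc : binomCoeff q t r ≠ 0) :
    IsMacdonald q t (oneRow n r) ((binomCoeff q t r)⁻¹ • oneRowPoly n q t r) := by
  obtain ⟨m, rfl⟩ : ∃ m, n = m + 1 := ⟨n - 1, by omega⟩
  constructor
  · refine IsWeylInvariant.mem_span
      (((isWeylInvariant_oneRowPoly _ q t r).smul _).sub (isWeylInvariant_orbitSum _))
      fun ν hν h => ?_
    have hcoeff : ((binomCoeff q t r)⁻¹ • oneRowPoly (m + 1) q t r -
        orbitSum (oneRow (m + 1) r)).coeff ν =
        (binomCoeff q t r)⁻¹ * (oneRowPoly (m + 1) q t r).coeff ν -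
          if ν ∈ weylOrbit (oneRow (m + 1) r) then 1 else 0 := by
      rw [← coeff_orbitSum]
      rfl
    rw [hcoeff] at h
    have hne : ν ≠ oneRow (m + 1) r := by
      rintro rfl
      rw [coeff_oneRowPoly_oneRow, if_pos (self_mem_weylOrbit _), inv_mul_cancel₀ hc,
        sub_self] at h
      exact h rfl
    rw [if_neg (fun h' => hne (eq_of_isDominant_of_mem_weylOrbit (isDominant_oneRow m r) hν h')),
      sub_zero] at h
    exact weightLT_of_degreeLE hν (degreeLE_of_coeff_oneRowPoly_ne_zero (right_ne_zero_of_mul h)) hne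
  · rw [macdonaldE_smul hq0, macdonaldE_oneRowPoly hn hq0 hq1 ht, smul_comm (eigen q t _),
      algebraMap_smul_ratFun (binomCoeff q t r)⁻¹, Algebra.smul_def]

lemma eigen_one_weylAct (π : Equiv.Perm (Fin n)) (ε : Fin n → ℤˣ) (μ : Weight n) :
    eigen q 1 (weylAct π ε μ) = eigen q 1 μ := by
  rw [eigen, eigen]
  refine Eq.trans (Finset.prod_congr rfl fun i _ => ?_) (Equiv.prod_comp π _)
  rw [weylAct_apply]
  rcases Int.units_eq_one_or (ε i) with h | h <;> simp [h, add_comm]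

/-- At t = 1 all weights are 1, so the operator is diagonal on monomials, with an eigenvalue that is
constant on orbits. -/
lemma isMacdonald_orbitSum (hq : 0 < q) (μ : Weight n) : IsMacdonald q 1 μ (orbitSum μ) := by
  constructor
  · rw [sub_self]
    exact zero_mem _
  · rw [macdonaldE_eq hq]
    have hW := fun σ => rootWeight_one ((genericPoint_coordFun (n := n) one_ne_zero).one_sub_ne_zero σ)
    simp only [map_one, hW, one_mul]
    rw [← map_sum]
    congr 1
    ext ν
    rw [AddMonoidAlgebra.coeff_sum, Finsupp.finsetSum_apply]
    simp only [coeff_shiftHom, ← Finset.sum_mul]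
    have h := eigen_eq_sum q 1 (κ := ν) hq
    simp only [ite_self, one_pow, Finset.prod_const_one, one_mul] at h
    rw [← h, AddMonoidAlgebra.coeff_smul, Finsupp.smul_apply, smul_eq_mul, coeff_orbitSum]
    split_ifs with hν
    · obtain ⟨π, ε, rfl⟩ := mem_weylOrbit.mp hν
      rw [eigen_one_weylAct]
    · simp

lemma existsUnique_isMacdonald (hn : 2 ≤ n) (hq0 : 0 < q) (hq1 : q < 1) (ht : 0 < t) {N : ℕ}
    (hgen : 1 < t → ∀ r : ℕ, r ≤ N → ∀ μ : Weight n, IsDominant μ →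
      WeightLT μ (oneRow n r) → eigen q t μ ≠ eigen q t (oneRow n r)) {r : ℕ} (hr : r ≤ N) :
    ∃! P : LaurentAlg n, IsMacdonald q t (oneRow n r) P := by
  have hgen' : ∀ μ : Weight n, IsDominant μ → WeightLT μ (oneRow n r) →
      eigen q t μ ≠ eigen q t (oneRow n r) := by
    intro μ hμ hlt
    rcases lt_or_ge 1 t with h1 | h1
    · exact hgen h1 r hr μ hμ hlt
    · obtain ⟨m, rfl⟩ : ∃ m, n = m + 1 := ⟨n - 1, by omega⟩
      exact (eigen_lt_eigen_oneRow hq0 hq1 ht h1 hμ hlt).ne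
  obtain ⟨P, hP⟩ : ∃ P : LaurentAlg n, IsMacdonald q t (oneRow n r) P := by
    rcases eq_or_ne t 1 with rfl | ht1
    · exact ⟨_, isMacdonald_orbitSum hq0 _⟩
    · exact ⟨_, isMacdonald_smul_oneRowPoly hn hq0 hq1 ht
        (binomCoeff_ne_zero hn hq0 hq1 ht ht1 hgen hr)⟩
  exact ⟨P, hP, fun P' hP' => hP'.eq_of_generic hq0 hgen' hP⟩

lemma macdonaldQ_eq_oneRowPoly (hn : 2 ≤ n) (hq0 : 0 < q) (hq1 : q < 1) (ht : 0 < t) {N : ℕ}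
    (hgen : 1 < t → ∀ r : ℕ, r ≤ N → ∀ μ : Weight n, IsDominant μ →
      WeightLT μ (oneRow n r) → eigen q t μ ≠ eigen q t (oneRow n r)) {r : ℕ} (hr : r ≤ N) :
    macdonaldQ n q t r = oneRowPoly n q t r := by
  have hun := existsUnique_isMacdonald hn hq0 hq1 ht hgen hr
  have hQ : macdonaldQ n q t r = binomCoeff q t r • macdonaldP q t (oneRow n r) := rfl
  -- The coefficient vanishes only for t = 1 and r > 0, where both sides are 0. Otherwise uniqueness
  -- identifies the chosen polynomial.
  by_cases hc : binomCoeff q t r = 0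
  · have ht1 : t = 1 := by
      by_contra h
      exact binomCoeff_ne_zero hn hq0 hq1 ht h hgen hr hc
    subst ht1
    have hr0 : r ≠ 0 := by
      rintro rfl
      rw [binomCoeff_zero] at hc
      exact one_ne_zero hc
    rw [hQ, hc, zero_smul, oneRowPoly_one n q hr0]
  · have hP : IsMacdonald q t (oneRow n r) (macdonaldP q t (oneRow n r)) := by
      rw [macdonaldP, dif_pos hun.exists]
      exact hun.exists.choose_spec
    rw [hQ, hun.unique hP (isMacdonald_smul_oneRowPoly hn hq0 hq1 ht hc), smul_smul,
      mul_inv_cancel₀ hc, one_smul]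

end Existence

end MacdonaldC

/-! ### The theorem -/

theorem theorem4 (n : ℕ) (hn : 2 ≤ n) (q t : ℝ) (hq0 : 0 < q) (hq1 : q < 1) (ht : 0 < t)
    (a b : ℕ) (hab : b ≤ a)
    (hgen : 1 < t → ∀ r : ℕ, r ≤ a + b → ∀ μ : Weight n, IsDominant μ →
      WeightLT μ (oneRow n r) → eigen q t μ ≠ eigen q t (oneRow n r)) :
    (∀ r : ℕ, r ≤ a + b → ∃! P : LaurentAlg n, IsMacdonald q t (oneRow n r) P) ∧
    macdonaldE q t (macdonaldQ n q t a * macdonaldQ n q t b) =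
      algebraMap (LaurentAlg n) (RatFun n)
        (eigen q t (twoRow n a b) • (macdonaldQ n q t a * macdonaldQ n q t b) +
          ((1 - t) * ∏ i ∈ Finset.Icc 1 (n - 2), (t ^ i + 1)) •
            ((Real.sqrt q ^ (-((a : ℤ) - b)) * t ^ (n - 1)) •
                ∑ k ∈ Finset.Icc 1 b,
                  ((q ^ k)⁻¹ * (1 - q ^ (2 * (k : ℤ) + a - b))) •
                    (macdonaldQ n q t (a + k) * macdonaldQ n q t (b - k)) -
              (Real.sqrt q ^ (-((a : ℤ) + b))) •
                ∑ k ∈ Finset.Icc 1 b,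
                  (t ^ (k - 1) * (1 - q ^ (-2 * (k : ℤ) + a + b) * t ^ (2 * n))) •
                    (macdonaldQ n q t (a - k) * macdonaldQ n q t (b - k)))) := by
  refine ⟨fun r hr => existsUnique_isMacdonald hn hq0 hq1 ht hgen hr, ?_⟩
  -- The largest index that occurs is `a + k` with `k = b`, whence the range of genericity.
  have hQ : ∀ r, r ≤ a + b → macdonaldQ n q t r = oneRowPoly n q t r := fun r hr =>
    macdonaldQ_eq_oneRowPoly hn hq0 hq1 ht hgen hr
  have h1 : ∀ k ∈ Finset.Icc 1 b, ((q ^ k)⁻¹ * (1 - q ^ (2 * (k : ℤ) + a - b))) •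
      (macdonaldQ n q t (a + k) * macdonaldQ n q t (b - k)) =
      ((q ^ k)⁻¹ * (1 - q ^ (2 * (k : ℤ) + a - b))) •
        (oneRowPoly n q t (a + k) * oneRowPoly n q t (b - k)) := fun k hk => by
    have hk := (Finset.mem_Icc.mp hk).2
    rw [hQ (a + k) (by omega), hQ (b - k) (by omega)]
  have h2 : ∀ k ∈ Finset.Icc 1 b, (t ^ (k - 1) * (1 - q ^ (-2 * (k : ℤ) + a + b) * t ^ (2 * n))) •
      (macdonaldQ n q t (a - k) * macdonaldQ n q t (b - k)) =
      (t ^ (k - 1) * (1 - q ^ (-2 * (k : ℤ) + a + b) * t ^ (2 * n))) •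
        (oneRowPoly n q t (a - k) * oneRowPoly n q t (b - k)) := fun k hk => by
    rw [hQ (a - k) (by omega), hQ (b - k) (by omega)]
  rw [Finset.sum_congr rfl h1, Finset.sum_congr rfl h2, hQ a (by omega), hQ b (by omega)]
  exact macdonaldE_oneRowPoly_mul hn hq0 hq1 ht hab
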